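/- **The game.** There are $n$ cups, initially empty, with fills that are multiples of $1/2$. In each step the filler places a total of one unit of water into the cups; then the emptier sees the state $S$ of all fills, selects one cup, and either removes exactly $1$ unit from it (possible only if it holds at least $1$) or skips its turn. There is no resource augmentation. The emptier is *stateless*: its selection and its decision to remove or skip are functions of the current state. It is *score-based* if there are functions $\sigma_1,\dots,\sigma_n:\mathbb R\to\mathbb R$, strictly increasing on $[0,\infty)$ and such that the numbers $\sigma_i(j/2)$ ($1\le i\le n$, $j\ge 1$) are pairwise distinct, such that in every state the selected cup $j$ maximizes $\sigma_j(f_j)$, where $f_j$ is the fill of cup $j$. (If an empty cup ties for the maximum, any maximizer may be selected.) It is *monotone* if, whenever cup $j$ is selected in a state $S$, it is still selected after the water in some cup $i\ne j$ is reduced. The decision to remove or skip is unrestricted in both cases. **The oblivious fuzzing filler with phase length $L$.** It first relabels the cups by a uniformly random permutation, and then plays $n$ phases of $L$ steps each. The $i$-th phase is called the $(n-i+1)$-cup phase; in each of its steps the filler draws $x_1,x_2\in\{1,\dots,n-i+1\}$ independently and uniformly and places $1/2$ unit of water into each of the cups labelled $x_1$ and $x_2$ (a full unit if $x_1=x_2$).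 **Theorem.** There is a constant $c\in\mathbb N$ for which the following two statements hold. 1. There are $\kappa>0$ and $N$ such that for all $n\ge N$, all $L\ge n^{cn}$ and every emptier on $n$ cups that is score-based, or monotone and stateless: if it plays against the oblivious fuzzing filler with phase length $L$ and $k=\lfloor n^{2/3}\rfloor$, then at the beginning of the $k$-cup phase the average fill of the cups labelled $1,\dots,k$ has expected value at least $\kappa\log n$. 2. No such emptier has an unending $o(\log n)$ backlog guarantee, where the backlog is the fill of the fullest cup. That is, for every function $g(n)=o(\log n)$ and every $a>1$ there is $N$ such that for all $n\ge N$, all $L\ge n^{cn}$ and every emptier on $n$ cups that is score-based, or monotone and stateless, playing against the oblivious fuzzing filler with phase length $L$: (i) it is not true that after every step the expected backlog is at most $g(n)$; and (ii) it is not true that after every step the backlog is at most $g(n)$ with probability at least $1-n^{-a}$. -/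

import Mathlib

open Finset
open scoped BigOperators

namespace CupGame

/-- A state of `n` cups.  All water moves in multiples of `1/2`, so a state records, for each cup,
its amount of water counted in half-units: cup `j` has fill `S j / 2`. -/
abbrev State (n : ℕ) : Type := Fin n → ℕ

/-- The fill of cup `j`, in units of water. -/
noncomputable def fill {n : ℕ} (S : State n) (j : Fin n) : ℝ := (S j : ℝ) / 2

/-- The backlog of a state: the fill of the fullest cup. -/
noncomputable def backlog {n : ℕ} (S : State n) : ℝ := ((univ.sup S : ℕ) : ℝ) / 2

/-- A stateless emptier: both its choice of a cup and its decision whether to remove a unit of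
water from that cup (`true`) or to skip its turn (`false`) are functions of the current state. -/
structure Emptier (n : ℕ) where
  /-- the selected cup -/
  select : State n → Fin n
  /-- whether the emptier wants to remove a unit from the selected cup -/
  removes : State n → Bool

namespace Emptier

variable {n : ℕ}

/-- Monotonicity: reducing the water in a cup which is not the selected one does not change the
selection. -/
def IsMonotone (A : Emptier n) : Prop :=
  ∀ (S : State n) (i : Fin n) (x : ℕ), i ≠ A.select S → x < S i →
    A.select (Function.update S i x) = A.select S

/-- A score-based emptier: there are strictly increasing score functions `σ j` of the fill, with
all scores at positive multiples of `1/2` distinct, such that the selected cup always maximizes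
`σ j (fill of j)`.  (A tie can only involve empty cups; then any maximizer may be selected.) -/
def IsScoreBased (A : Emptier n) : Prop :=
  ∃ σ : Fin n → ℝ → ℝ,
    (∀ j, StrictMonoOn (σ j) (Set.Ici 0)) ∧
    (∀ i j : Fin n, ∀ a b : ℕ, 0 < a → 0 < b →
      σ i ((a : ℝ) / 2) = σ j ((b : ℝ) / 2) → i = j ∧ a = b) ∧
    ∀ (S : State n) (j : Fin n), σ j (fill S j) ≤ σ (A.select S) (fill S (A.select S))

/-- The emptier's move: one full unit (two half-units) leaves the selected cup, provided that the
emptier does not skip and that the cup holds a full unit. -/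
def move (A : Emptier n) (S : State n) : State n :=
  if A.removes S = true ∧ 2 ≤ S (A.select S) then
    Function.update S (A.select S) (S (A.select S) - 2)
  else S

end Emptier

/-- The random choices of the oblivious fuzzing filler on `n` cups with phases of `L` steps:
a relabelling of the cups (the filler's cup `x` is the actual cup `ω.1 x`), and for every step `t`
of the `n * L` steps a pair of cups among the filler's first `n - i` cups, where `i = t / L` is the
number of phases completed before step `t`.  Uniform choice from this finite type means a uniform
permutation and independent uniform `x₁, x₂` in all steps. -/
abbrev Fuzz (n L : ℕ) : Type :=
  Equiv.Perm (Fin n) ×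
    ((t : Fin (n * L)) → Fin (n - (t.divNat : ℕ)) × Fin (n - (t.divNat : ℕ)))

/-- Expectation over the filler's random choices. -/
noncomputable def expectation {n L : ℕ} (X : Fuzz n L → ℝ) : ℝ :=
  (∑ ω : Fuzz n L, X ω) / (Fintype.card (Fuzz n L) : ℝ)

open Classical in
/-- Probability over the filler's random choices. -/
noncomputable def probability {n L : ℕ} (P : Fuzz n L → Prop) : ℝ :=
  expectation fun ω : Fuzz n L => if P ω then 1 else 0

/-- The actual cup behind the label `x` in the step `t`. -/
def cupOf {n L : ℕ} (ω : Fuzz n L) (t : Fin (n * L)) (x : Fin (n - (t.divNat : ℕ))) : Fin n :=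
  ω.1 (Fin.castLE (Nat.sub_le _ _) x)

/-- The filler's move in step `t`: a half-unit into each of the two chosen cups
(a full unit if they coincide). -/
def pour {n L : ℕ} (ω : Fuzz n L) (t : Fin (n * L)) (S : State n) : State n := fun j =>
  S j + (if cupOf ω t (ω.2 t).1 = j then 1 else 0) + (if cupOf ω t (ω.2 t).2 = j then 1 else 0)

/-- The state after `t` steps of the game (all cups are empty in the beginning; in each step the
filler moves and then the emptier moves; the game ends after `n * L` steps). -/
def stateAfter {n L : ℕ} (A : Emptier n) (ω : Fuzz n L) : ℕ → State n
  | 0 => fun _ => 0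
  | t + 1 =>
    if h : t < n * L then A.move (pour ω ⟨t, h⟩ (stateAfter A ω t)) else stateAfter A ω t

/-- The state at the beginning of the `k`-cup phase: `n - k` phases of `L` steps have passed. -/
def stateAtPhase {n L : ℕ} (A : Emptier n) (ω : Fuzz n L) (k : ℕ) : State n :=
  stateAfter A ω ((n - k) * L)

/-- The average fill of the filler's first `k` cups in the state `S`. -/
noncomputable def averageFill {n L : ℕ} (ω : Fuzz n L) (k : ℕ) (S : State n) : ℝ :=
  (∑ x ∈ univ.filter (fun x : Fin n => (x : ℕ) < k), fill S (ω.1 x)) / (k : ℝ)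

namespace Emptier

variable {n : ℕ}

/-- Against the fuzzing filler with phases of `L` steps, after every step the expected backlog
is at most `b`. -/
def ExpectedBacklogGuarantee (A : Emptier n) (L : ℕ) (b : ℝ) : Prop :=
  ∀ t ≤ n * L, expectation (fun ω : Fuzz n L => backlog (stateAfter A ω t)) ≤ b

/-- Against the fuzzing filler with phases of `L` steps, after every step the backlog is at most
`b` with probability at least `1 - p`. -/
def BacklogGuarantee (A : Emptier n) (L : ℕ) (b p : ℝ) : Prop :=
  ∀ t ≤ n * L, 1 - p ≤ probability (fun ω : Fuzz n L => backlog (stateAfter A ω t) ≤ b)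

end Emptier

end CupGame

/-! Count water in half-units. For every nonempty set C of cups and every m there is a threshold
profile H on C of total m: once some cup of C exceeds its threshold, the emptier takes no water from
cups of C at or below theirs (`exists_isThreshold`). Nothing else about score-based or monotone
emptiers is used.

Let C be the j+1 cups of the phase just ended, and let H have total two more than the water in C.
Since the emptier removes two half-units at a time, it cannot influence parities. These perform a
random walk on the hypercube and end nearly uniform, up to the total parity
(`expectation_pow_mismatch_le`). So the state typically differs from H in at least (j+1)/8 cups, and
as the totals almost agree, the cups exceed H by about (j+1)/16 altogether
(`le_expectation_sum_overflow`). By symmetry the cup dropped next is a uniform cup of C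
(`expectation_last_active`), so its expected excess is at least a constant.

In the next phase the dropped cup, being above its threshold, makes the emptier respect H on the
remaining cups B, and its excess is the room that H leaves for extra water in B, up to the two spare
half-units. The water in B never decreases; while room is left, some pair of cups makes it grow or
brings the state closer to H (`exists_good_step`). A potential with drift at least (2j²)^(-j) shows
that n^(4n) steps fill the room except with small probability (`sum_potential_step_le`,
`expectation_overflow_le`).

Thus the average over the active cups gains a constant over j in the j-cup phase
(`le_expectation_gain`), and dropping a random cup preserves it in expectation. Summing from n down
to n^(2/3) gives order log n (`log_growth`). The backlog is at least the average, which settles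
expected guarantees. For guarantees with high probability the recursion runs on the event that the
backlog has stayed below g at the phase boundaries; leaving it costs at most 4g n^(-a) per phase,
hence O(g) in total. -/

namespace CupGame

variable {n : ℕ}

/-! ### Threshold profiles -/

/-- The state after pouring half-units into the cups `a` and `b`. -/
def addTwo (S : State n) (a b : Fin n) : State n := fun j =>
  S j + (if a = j then 1 else 0) + (if b = j then 1 else 0)

namespace Emptier

/-- One step of the game in which the filler chooses the cups `a` and `b`. -/
def step (A : Emptier n) (S : State n) (a b : Fin n) : State n := A.move (addTwo S a b)

/-- A threshold profile on `C`: as soon as some cup of `C` exceeds its threshold, the emptier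
selects no nonempty cup of `C` which does not exceed its threshold. -/
def IsThreshold (A : Emptier n) (C : Finset (Fin n)) (H : Fin n → ℕ) : Prop :=
  ∀ S : State n, (∃ r ∈ C, H r < S r) → A.select S ∈ C → S (A.select S) ≠ 0 →
    H (A.select S) < S (A.select S)

theorem sum_add_single (C : Finset (Fin n)) (H : Fin n → ℕ) {s : Fin n} (hs : s ∈ C) :
    ∑ i ∈ C, (H i + if i = s then 1 else 0) = ∑ i ∈ C, H i + 1 := by
  simp [sum_add_distrib, hs]

/-- Greedy construction: raise, one half-unit at a time, the threshold whose next level has the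
smallest score. Then every positive threshold scores less than the next level of every other cup. -/
theorem IsScoreBased.exists_isThreshold {A : Emptier n} (hA : A.IsScoreBased)
    {C : Finset (Fin n)} (hC : C.Nonempty) (m : ℕ) :
    ∃ H : Fin n → ℕ, A.IsThreshold C H ∧ ∑ i ∈ C, H i = m := by
  obtain ⟨σ, hmono, hdist, hsel⟩ := hA
  have hlt : ∀ (j : Fin n) (a b : ℕ), a < b → σ j ((a : ℝ) / 2) < σ j ((b : ℝ) / 2) := by
    intro j a b hab
    apply hmono j
    · simp only [Set.mem_Ici]; positivity
    · simp only [Set.mem_Ici]; positivity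
    · have : (a : ℝ) < b := by exact_mod_cast hab
      linarith
  have hle : ∀ (j : Fin n) (a b : ℕ), a ≤ b → σ j ((a : ℝ) / 2) ≤ σ j ((b : ℝ) / 2) := by
    intro j a b hab
    rcases hab.eq_or_lt with h | h
    · rw [h]
    · exact (hlt j a b h).le
  have key : ∃ H : Fin n → ℕ, (∀ i ∈ C, ∀ r ∈ C, i ≠ r → 0 < H i →
      σ i ((H i : ℝ) / 2) < σ r (((H r + 1 : ℕ) : ℝ) / 2)) ∧ ∑ i ∈ C, H i = m := by
    induction m with
    | zero => exact ⟨fun _ => 0, by simp, by simp⟩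
    | succ m ih =>
      obtain ⟨H, hH, hsum⟩ := ih
      obtain ⟨s, hs, hmin⟩ := C.exists_min_image (fun i => σ i (((H i + 1 : ℕ) : ℝ) / 2)) hC
      refine ⟨fun i => H i + if i = s then 1 else 0, ?_, by rw [sum_add_single C H hs, hsum]⟩
      intro i hi r hr hir hpos
      dsimp only at hpos ⊢
      by_cases his : i = s
      · subst his
        have hri : r ≠ i := fun h => hir h.symm
        simp only [if_true, if_neg hri, add_zero]
        -- Distinctness of the scores at positive levels turns minimality into a strict inequality.
        refine lt_of_le_of_ne (hmin r hr) fun h => hir ?_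
        exact (hdist i r _ _ (Nat.succ_pos _) (Nat.succ_pos _) h).1
      · simp only [if_neg his, add_zero] at hpos ⊢
        exact (hH i hi r hr hir hpos).trans_le (hle r _ _ (by omega))
  obtain ⟨H, hH, hsum⟩ := key
  refine ⟨H, ?_, hsum⟩
  rintro S ⟨r, hr, hrS⟩ hselC h0
  by_contra hcon
  push Not at hcon
  have hne : A.select S ≠ r := by
    intro h
    rw [h] at hcon
    omega
  have h1 := hH _ hselC r hr hne (by omega)
  have h2 := hsel S r
  have h3 := hle r _ _ (Nat.succ_le_of_lt hrS)
  have h4 := hle (A.select S) _ _ hcon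
  simp only [fill] at h2
  exact absurd (((h3.trans h2).trans h4)) (not_le.mpr h1)

/-- Lower the cups one by one; the selected cup is never among those that change. -/
theorem IsMonotone.select_eq_of_le {A : Emptier n} (hA : A.IsMonotone) {S T : State n}
    (hle : ∀ i, T i ≤ S i) (heq : T (A.select S) = S (A.select S)) :
    A.select T = A.select S := by
  have key : ∀ D : Finset (Fin n),
      A.select (fun i => if i ∈ D then T i else S i) = A.select S := by
    intro D
    induction D using Finset.induction_on with
    | empty => simp
    | insert a D ha ih =>
      by_cases hTa : T a = S a
      · rw [← ih]
        congr 1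
        funext i
        by_cases hi : i = a
        · subst hi; simp [ha, hTa]
        · simp [hi]
      · have hne : a ≠ A.select (fun i => if i ∈ D then T i else S i) := by
          rw [ih]; rintro rfl; exact hTa heq
        have := hA (fun i => if i ∈ D then T i else S i) a (T a) hne (by
          simp only [ha, if_false]
          exact lt_of_le_of_ne (hle a) hTa)
        rw [ih] at this
        rw [← this]
        congr 1
        funext i
        by_cases hi : i = a
        · subst hi; simp
        · simp [hi]
  simpa using key univ

/-- A substitute for the cup of minimal score: one that is not selected in any two-cup comparison.
If the selected cup lies in `D`, it wins all its comparisons, so it can be removed and a loser found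
among the rest. -/
theorem IsMonotone.exists_minimal {A : Emptier n} (hA : A.IsMonotone) (f : Fin n → ℕ)
    (D : Finset (Fin n)) (hD : D.Nonempty) :
    ∃ s ∈ D, ∀ r ∈ D, s ≠ r →
      A.select (fun x => if x = s then f s else if x = r then f r else 0) ≠ s := by
  induction D using Finset.strongInduction with
  | H D ih =>
    set T : State n := fun x => if x ∈ D then f x else 0 with hT
    have hpair : ∀ s ∈ D, ∀ r ∈ D, (A.select T ∉ D ∨ A.select T = s ∨ A.select T = r) →
        A.select (fun x => if x = s then f s else if x = r then f r else 0) = A.select T := by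
      intro s hs r hr h
      apply hA.select_eq_of_le
      · intro i
        by_cases h1 : i = s
        · subst h1; simp [hT, hs]
        · by_cases h2 : i = r
          · subst h2; simp [hT, hr, h1]
          · simp [h1, h2]
      · rcases h with h | h | h
        · have h1 : A.select T ≠ s := fun e => h (e ▸ hs)
          have h2 : A.select T ≠ r := fun e => h (e ▸ hr)
          simp only [h1, h2, if_false]
          simp only [hT] at h ⊢
          simp [h]
        · rw [h]; simp [hT, hs]
        · rw [h]
          by_cases hrs : r = s
          · subst hrs; simp [hT, hr]
          · simp [hT, hr, hrs]
    by_cases ht : A.select T ∈ D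
    · by_cases hne : (D.erase (A.select T)).Nonempty
      · obtain ⟨s, hs, hmin⟩ := ih (D.erase (A.select T)) (erase_ssubset ht) hne
        obtain ⟨hst, hsD⟩ := mem_erase.mp hs
        refine ⟨s, hsD, fun r hr hsr => ?_⟩
        by_cases hrt : r = A.select T
        · rw [hpair s hsD r hr (Or.inr (Or.inr hrt.symm))]
          exact fun e => hst e.symm
        · exact hmin r (mem_erase.mpr ⟨hrt, hr⟩) hsr
      · refine ⟨A.select T, ht, fun r hr hsr => ?_⟩
        exact absurd ⟨r, mem_erase.mpr ⟨fun e => hsr e.symm, hr⟩⟩ hne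
    · obtain ⟨s, hs⟩ := hD
      refine ⟨s, hs, fun r hr hsr => ?_⟩
      rw [hpair s hs r hr (Or.inl ht)]
      exact fun e => ht (e ▸ hs)

/-- The same greedy construction, with scores replaced by the selection in states where at most two
cups hold water. -/
theorem IsMonotone.exists_isThreshold {A : Emptier n} (hA : A.IsMonotone)
    {C : Finset (Fin n)} (hC : C.Nonempty) (m : ℕ) :
    ∃ H : Fin n → ℕ, A.IsThreshold C H ∧ ∑ i ∈ C, H i = m := by
  have hdown : ∀ (i r : Fin n) (a b b' : ℕ), i ≠ r → b ≤ b' →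
      A.select (fun x => if x = i then a else if x = r then b' else 0) = i →
      A.select (fun x => if x = i then a else if x = r then b else 0) = i := by
    intro i r a b b' hir hb h
    rw [hA.select_eq_of_le (S := fun x => if x = i then a else if x = r then b' else 0), h]
    · intro x
      by_cases h1 : x = i
      · simp [h1]
      · by_cases h2 : x = r
        · simpa only [if_neg h1, if_pos h2] using hb
        · simp [h1, h2]
    · rw [h]; simp
  have hup : ∀ (i r : Fin n) (a a' b : ℕ), i ≠ r → a ≤ a' →
      A.select (fun x => if x = i then a else if x = r then b else 0) = i →
      A.select (fun x => if x = i then a' else if x = r then b else 0) = i := by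
    intro i r a a' b hir ha h
    by_contra hne
    have := hA.select_eq_of_le (S := fun x => if x = i then a' else if x = r then b else 0)
      (T := fun x => if x = i then a else if x = r then b else 0) (by
        intro x
        by_cases h1 : x = i
        · simp [h1, ha]
        · simp [h1]) (by simp [hne])
    exact hne (this ▸ h)
  have key : ∃ H : Fin n → ℕ, (∀ i ∈ C, ∀ r ∈ C, i ≠ r → 0 < H i →
      A.select (fun x => if x = i then H i else if x = r then H r + 1 else 0) ≠ i) ∧
      ∑ i ∈ C, H i = m := by
    induction m with
    | zero => exact ⟨fun _ => 0, by simp, by simp⟩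
    | succ m ih =>
      obtain ⟨H, hH, hsum⟩ := ih
      obtain ⟨s, hs, hmin⟩ := hA.exists_minimal (fun i => H i + 1) C hC
      refine ⟨fun i => H i + if i = s then 1 else 0, ?_, by rw [sum_add_single C H hs, hsum]⟩
      intro i hi r hr hir hpos
      dsimp only at hpos ⊢
      by_cases his : i = s
      · subst his
        have hri : r ≠ i := fun h => hir h.symm
        simpa only [if_true, if_neg hri, add_zero] using hmin r hr hir
      · simp only [if_neg his, add_zero] at hpos ⊢
        exact fun h => hH i hi r hr hir hpos (hdown i r _ _ _ hir (by omega) h)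
  obtain ⟨H, hH, hsum⟩ := key
  refine ⟨H, ?_, hsum⟩
  rintro S ⟨r, hr, hrS⟩ hselC h0
  by_contra hcon
  push Not at hcon
  have hne : A.select S ≠ r := by
    intro h
    rw [h] at hcon
    omega
  -- Empty all cups but the selected one and `r`, lower `r` to just above its threshold, then raise
  -- the selected cup to its own: it stays selected, against the invariant.
  refine hH _ hselC r hr hne (by omega) (hup _ _ _ _ _ hne hcon ?_)
  apply hA.select_eq_of_le
  · intro x
    by_cases h1 : x = A.select S
    · simp [← h1]
    · by_cases h2 : x = r
      · subst h2
        simp only [h1, if_false, if_true]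
        omega
      · simp [h1, h2]
  · simp

theorem exists_isThreshold {A : Emptier n} (hA : A.IsScoreBased ∨ A.IsMonotone)
    {C : Finset (Fin n)} (hC : C.Nonempty) (m : ℕ) :
    ∃ H : Fin n → ℕ, A.IsThreshold C H ∧ ∑ i ∈ C, H i = m :=
  hA.elim (fun h => h.exists_isThreshold hC m) (fun h => h.exists_isThreshold hC m)

end Emptier

/-! ### One step against a threshold profile -/

/-- The total excess of the cups of `B` over the profile `H`. -/
def excess (B : Finset (Fin n)) (H : Fin n → ℕ) (S : State n) : ℕ := ∑ i ∈ B, (S i - H i)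

theorem sum_addTwo {B : Finset (Fin n)} {a b : Fin n} (ha : a ∈ B) (hb : b ∈ B) (S : State n) :
    ∑ i ∈ B, addTwo S a b i = ∑ i ∈ B, S i + 2 := by
  simp [addTwo, sum_add_distrib, ha, hb]

theorem excess_addTwo_le {B : Finset (Fin n)} {a b : Fin n} (ha : a ∈ B) (hb : b ∈ B)
    (H : Fin n → ℕ) (S : State n) : excess B H (addTwo S a b) ≤ excess B H S + 2 := by
  have : ∑ i ∈ B, ((S i - H i) + (if a = i then 1 else 0) + (if b = i then 1 else 0)) =
      excess B H S + 2 := by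
    simp [excess, sum_add_distrib, ha, hb]
  rw [← this]
  apply sum_le_sum
  intro i _
  simp only [addTwo]
  omega

/-- The first half-unit only fills space below the threshold. -/
theorem excess_addTwo_self_le {B : Finset (Fin n)} {a : Fin n} (ha : a ∈ B)
    {H : Fin n → ℕ} {S : State n} (h : S a < H a) :
    excess B H (addTwo S a a) ≤ excess B H S + 1 := by
  have : ∑ i ∈ B, ((S i - H i) + (if a = i then 1 else 0)) = excess B H S + 1 := by
    simp [excess, sum_add_distrib, ha]
  rw [← this]
  apply sum_le_sum
  intro i _
  by_cases hi : a = i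
  · subst hi
    simp only [addTwo, if_true]
    omega
  · simp [addTwo, hi]

theorem excess_addTwo_of_lt {B : Finset (Fin n)} {a b : Fin n} (hab : a ≠ b)
    {H : Fin n → ℕ} {S : State n} (ha : S a < H a) (hb : S b < H b) :
    excess B H (addTwo S a b) = excess B H S := by
  apply sum_congr rfl
  intro i _
  by_cases hi : a = i
  · subst hi
    simp only [addTwo, if_true, if_neg hab.symm]
    omega
  · by_cases hi' : b = i
    · subst hi'
      simp only [addTwo, if_true, if_neg hi]
      omega
    · simp [addTwo, hi, hi']

theorem sum_comp_update (B : Finset (Fin n)) {i : Fin n} (hi : i ∈ B) (S : State n) (v : ℕ)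
    (f : Fin n → ℕ → ℕ) :
    ∑ x ∈ B, f x (Function.update S i v x) + f i (S i) = ∑ x ∈ B, f x (S x) + f i v := by
  rw [← add_sum_erase B _ hi, ← add_sum_erase B (fun x => f x (S x)) hi]
  have : ∑ x ∈ B.erase i, f x (Function.update S i v x) = ∑ x ∈ B.erase i, f x (S x) := by
    apply sum_congr rfl
    intro x hx
    rw [Function.update_of_ne (ne_of_mem_erase hx)]
  rw [this, Function.update_self]
  ring

namespace Emptier

theorem sum_move_cases (A : Emptier n) (B : Finset (Fin n)) (S : State n) :
    ∑ i ∈ B, A.move S i = ∑ i ∈ B, S i ∨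
      (A.select S ∈ B ∧ 2 ≤ S (A.select S) ∧
        A.move S = Function.update S (A.select S) (S (A.select S) - 2)) := by
  unfold move
  split_ifs with h
  · by_cases hB : A.select S ∈ B
    · exact Or.inr ⟨hB, h.2, rfl⟩
    · left
      apply sum_congr rfl
      intro i hi
      rw [Function.update_of_ne]
      rintro rfl
      exact hB hi
  · exact Or.inl rfl

theorem sum_le_sum_move (A : Emptier n) (B : Finset (Fin n)) (S : State n) :
    ∑ i ∈ B, S i ≤ ∑ i ∈ B, A.move S i + 2 := by
  rcases A.sum_move_cases B S with h | ⟨hB, h2, h⟩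
  · omega
  · have := sum_comp_update B hB S (S (A.select S) - 2) (fun _ x => x)
    rw [h]
    omega

theorem sum_le_sum_step (A : Emptier n) {B : Finset (Fin n)} {a b : Fin n} (ha : a ∈ B)
    (hb : b ∈ B) (S : State n) : ∑ i ∈ B, S i ≤ ∑ i ∈ B, A.step S a b i := by
  have h1 := A.sum_le_sum_move B (addTwo S a b)
  rw [sum_addTwo ha hb] at h1
  exact Nat.le_of_add_le_add_right h1

/-- An emptier that spares `B` lets its water grow; otherwise, `r` being above its threshold, the
unit leaves a cup of `B` above its own threshold. -/
theorem step_cases {A : Emptier n} {B C : Finset (Fin n)} {H : Fin n → ℕ}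
    (hH : A.IsThreshold C H) (hBC : B ⊆ C) {r : Fin n} (hr : r ∈ C)
    {S : State n} {a b : Fin n} (ha : a ∈ B) (hb : b ∈ B) (hrS : H r < S r) :
    ∑ i ∈ B, S i < ∑ i ∈ B, A.step S a b i ∨
      (∑ i ∈ B, A.step S a b i = ∑ i ∈ B, S i ∧
        excess B (fun i => H i - 1) (A.step S a b) + 2 =
          excess B (fun i => H i - 1) (addTwo S a b) ∧
        excess B H (A.step S a b) < excess B H (addTwo S a b)) := by
  have hsum := sum_addTwo ha hb S
  rcases A.sum_move_cases B (addTwo S a b) with h | ⟨hB, h2, h⟩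
  · left
    unfold step
    omega
  · right
    set T := addTwo S a b with hT
    have hlt : H (A.select T) < T (A.select T) := by
      refine hH T ⟨r, hr, ?_⟩ (hBC hB) (by omega)
      simp only [hT, addTwo]
      omega
    have e1 := sum_comp_update B hB T (T (A.select T) - 2) (fun _ x => x)
    have e2 := sum_comp_update B hB T (T (A.select T) - 2) (fun i x => x - (H i - 1))
    have e3 := sum_comp_update B hB T (T (A.select T) - 2) (fun i x => x - H i)
    simp only [step, excess, ← hT, h]
    -- The excess over `H - 1` loses the full two half-units: the cup is above its threshold, and if
    -- that threshold is 0, where `H - 1` truncates, it still holds at least two.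
    refine ⟨?_, ?_, ?_⟩ <;> omega

/-- From every state in which the threshold profile leaves enough room, the filler has a good
choice: one which increases the water in `B`, or decreases the excess over the lowered profile,
or else decreases the excess over the profile itself. -/
theorem exists_good_step {A : Emptier n} {B C : Finset (Fin n)} {H : Fin n → ℕ}
    (hH : A.IsThreshold C H) (hBC : B ⊆ C) {r : Fin n} (hr : r ∈ C)
    {S : State n} (hrS : H r < S r) (hroom : ∑ i ∈ B, S i + 3 ≤ ∑ i ∈ B, H i) :
    ∃ a ∈ B, ∃ b ∈ B, ∑ i ∈ B, S i < ∑ i ∈ B, A.step S a b i ∨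
      (∑ i ∈ B, A.step S a b i = ∑ i ∈ B, S i ∧
        (excess B (fun i => H i - 1) (A.step S a b) < excess B (fun i => H i - 1) S ∨
          (excess B H (A.step S a b) < excess B H S ∧ excess B H S ≤ B.card))) := by
  -- A full unit into a cup at least two below its threshold adds at most 1 to the excess over `H -
  -- 1`, while a removal from `B` takes off 2. Without such a cup all deficits are 0 or 1.
  by_cases hvac : ∃ x ∈ B, S x < H x - 1
  · obtain ⟨x, hx, hlt⟩ := hvac
    refine ⟨x, hx, x, hx, ?_⟩
    rcases step_cases hH hBC hr hx hx hrS with h | ⟨h1, h2, -⟩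
    · exact Or.inl h
    · have h3 := excess_addTwo_self_le hx (H := fun i => H i - 1) hlt
      exact Or.inr ⟨h1, Or.inl (by omega)⟩
  · push Not at hvac
    have hbal : excess B H S + ∑ i ∈ B, H i = ∑ i ∈ B, (H i - S i) + ∑ i ∈ B, S i := by
      unfold excess
      rw [← sum_add_distrib, ← sum_add_distrib]
      apply sum_congr rfl
      intro i _
      omega
    have hind : ∑ i ∈ B, (H i - S i) = (B.filter fun i => S i < H i).card := by
      rw [card_filter]
      apply sum_congr rfl
      intro i hi
      have := hvac i hi
      split_ifs <;> omega
    have hcard : (B.filter fun i => S i < H i).card ≤ B.card := card_filter_le _ _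
    -- The number of cups one below their threshold is the excess plus the room, hence at least 3.
    -- Half-units into two of them create no excess, so a removal strictly decreases it.
    obtain ⟨a, ha, b, hb, hab⟩ := one_lt_card.mp
      (show 1 < (B.filter fun i => S i < H i).card by omega)
    rw [mem_filter] at ha hb
    refine ⟨a, ha.1, b, hb.1, ?_⟩
    rcases step_cases hH hBC hr ha.1 hb.1 hrS with h | ⟨h1, -, h2⟩
    · exact Or.inl h
    · rw [excess_addTwo_of_lt hab ha.2 hb.2] at h2
      exact Or.inr ⟨h1, Or.inr ⟨h2, by omega⟩⟩

end Emptier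

/-! ### The potential and its drift -/

theorem excess_le_sum (B : Finset (Fin n)) (H : Fin n → ℕ) (S : State n) :
    excess B H S ≤ ∑ i ∈ B, S i :=
  sum_le_sum fun _ _ => Nat.sub_le _ _

/-- The drift potential of the filler: it decreases in expectation as long as the water in `B`
is below `D`. -/
noncomputable def potential (B : Finset (Fin n)) (H : Fin n → ℕ) (D : ℕ) (S : State n) : ℝ :=
  if ∑ i ∈ B, S i < D then
    2 * (B.card : ℝ) ^ 2 * (D + 1) * (D - (∑ i ∈ B, S i : ℕ)) +
      2 * (B.card : ℝ) ^ 2 * excess B (fun i => H i - 1) S +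
      (1 - (1 / (2 * (B.card : ℝ) ^ 2)) ^ excess B H S)
  else 0

theorem potential_nonneg {B : Finset (Fin n)} (hB : B.Nonempty) (H : Fin n → ℕ) (D : ℕ)
    (S : State n) : 0 ≤ potential B H D S := by
  unfold potential
  split_ifs with h
  · have h1 : (1 : ℝ) ≤ B.card := by exact_mod_cast hB.card_pos
    have h2 : ((∑ i ∈ B, S i : ℕ) : ℝ) ≤ D := by exact_mod_cast h.le
    have h3 : (1 / (2 * (B.card : ℝ) ^ 2)) ^ excess B H S ≤ 1 := by
      apply pow_le_one₀ (by positivity)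
      rw [div_le_one (by positivity)]
      nlinarith
    have h4 : 0 ≤ 2 * (B.card : ℝ) ^ 2 * (D + 1) * (D - (∑ i ∈ B, S i : ℕ)) :=
      mul_nonneg (by positivity) (by linarith)
    have h5 : 0 ≤ 2 * (B.card : ℝ) ^ 2 * excess B (fun i => H i - 1) S := by positivity
    linarith
  · exact le_rfl

theorem potential_le {B : Finset (Fin n)} (hB : B.Nonempty) (H : Fin n → ℕ) (D : ℕ)
    (S : State n) : potential B H D S ≤ 2 * (B.card : ℝ) ^ 2 * (D + 2) ^ 2 := by
  have h1 : (1 : ℝ) ≤ B.card := by exact_mod_cast hB.card_pos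
  have hX : 2 ≤ 2 * (B.card : ℝ) ^ 2 := by nlinarith
  unfold potential
  split_ifs with h
  · have h2 : (excess B (fun i => H i - 1) S : ℝ) ≤ D := by
      exact_mod_cast (excess_le_sum B _ S).trans h.le
    have h3 : 0 ≤ (1 / (2 * (B.card : ℝ) ^ 2)) ^ excess B H S := by positivity
    have h4 : (0 : ℝ) ≤ (∑ i ∈ B, S i : ℕ) := by positivity
    have h5 : 2 * (B.card : ℝ) ^ 2 * (D + 1) * (D - (∑ i ∈ B, S i : ℕ)) ≤
        2 * (B.card : ℝ) ^ 2 * (D + 1) * D :=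
      mul_le_mul_of_nonneg_left (by linarith) (by positivity)
    have h6 : 2 * (B.card : ℝ) ^ 2 * excess B (fun i => H i - 1) S ≤
        2 * (B.card : ℝ) ^ 2 * D := mul_le_mul_of_nonneg_left h2 (by positivity)
    have h7 : (0 : ℝ) ≤ D := by positivity
    nlinarith
  · positivity

namespace Emptier

/-- The weight `D + 1` on missing water outweighs any rise of the excess over `H - 1`, which is at
most `D` while the water is below `D`; the last term rises by at most 1. -/
theorem potential_step_of_lt {B : Finset (Fin n)} (hB : B.Nonempty) (H : Fin n → ℕ) {D : ℕ}
    {S T : State n} (hS : ∑ i ∈ B, S i < D) (hlt : ∑ i ∈ B, S i < ∑ i ∈ B, T i) :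
    potential B H D T ≤ potential B H D S - 2 * (B.card : ℝ) ^ 2 + 1 := by
  have h1 : (1 : ℝ) ≤ B.card := by exact_mod_cast hB.card_pos
  have hX : 2 ≤ 2 * (B.card : ℝ) ^ 2 := by nlinarith
  set X := 2 * (B.card : ℝ) ^ 2 with hXdef
  have hθ : (1 / X) ^ excess B H S ≤ 1 := by
    apply pow_le_one₀ (by positivity)
    rw [div_le_one (by positivity)]
    linarith
  have hq : ((∑ i ∈ B, S i : ℕ) : ℝ) + 1 ≤ (∑ i ∈ B, T i : ℕ) := by exact_mod_cast hlt
  have hSD : ((∑ i ∈ B, S i : ℕ) : ℝ) + 1 ≤ D := by exact_mod_cast hS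
  have hΦ : 0 ≤ X * excess B (fun i => H i - 1) S := by positivity
  have hD : (0 : ℝ) ≤ D := by positivity
  unfold potential
  rw [if_pos hS, ← hXdef]
  split_ifs with h
  · have h2 : (excess B (fun i => H i - 1) T : ℝ) ≤ D := by
      exact_mod_cast (excess_le_sum B _ T).trans h.le
    have h3 : 0 ≤ (1 / X) ^ excess B H T := by positivity
    have h5 : X * (D + 1) * (D - (∑ i ∈ B, T i : ℕ)) ≤
        X * (D + 1) * (D - (∑ i ∈ B, S i : ℕ) - 1) :=
      mul_le_mul_of_nonneg_left (by linarith) (by positivity)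
    have h6 : X * excess B (fun i => H i - 1) T ≤ X * D :=
      mul_le_mul_of_nonneg_left h2 (by positivity)
    nlinarith
  · have h5 : X * (D + 1) * 1 ≤ X * (D + 1) * (D - (∑ i ∈ B, S i : ℕ)) :=
      mul_le_mul_of_nonneg_left (by linarith) (by positivity)
    have h6 : 0 ≤ X * D := by positivity
    nlinarith

theorem potential_step_of_eq {B : Finset (Fin n)} (H : Fin n → ℕ) {D : ℕ}
    {S T : State n} (hS : ∑ i ∈ B, S i < D) (heq : ∑ i ∈ B, T i = ∑ i ∈ B, S i) :
    potential B H D T = potential B H D S +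
      2 * (B.card : ℝ) ^ 2 * ((excess B (fun i => H i - 1) T : ℝ) -
        excess B (fun i => H i - 1) S) +
      (1 / (2 * (B.card : ℝ) ^ 2)) ^ excess B H S -
      (1 / (2 * (B.card : ℝ) ^ 2)) ^ excess B H T := by
  unfold potential
  rw [heq, if_pos hS, if_pos hS]
  ring

/-- The drift of the potential under a uniformly random choice of two cups of `B`. -/
theorem sum_potential_step_le {A : Emptier n} {B C : Finset (Fin n)} (hB : B.Nonempty)
    {H : Fin n → ℕ} (hH : A.IsThreshold C H) (hBC : B ⊆ C) {r : Fin n} (hr : r ∈ C) {D : ℕ}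
    (hD : D + 2 ≤ ∑ i ∈ B, H i) {S : State n} (hrS : ∑ i ∈ B, S i < D → H r < S r) :
    ∑ a ∈ B, ∑ b ∈ B, potential B H D (A.step S a b) ≤ (B.card : ℝ) ^ 2 *
      (potential B H D S -
        if ∑ i ∈ B, S i < D then (1 / (2 * (B.card : ℝ) ^ 2)) ^ B.card else 0) := by
  have h1 : (1 : ℝ) ≤ B.card := by exact_mod_cast hB.card_pos
  by_cases hS : ∑ i ∈ B, S i < D
  swap
  · have h0 : ∑ a ∈ B, ∑ b ∈ B, potential B H D (A.step S a b) = 0 := by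
      refine sum_eq_zero fun a ha => sum_eq_zero fun b hb => ?_
      have := A.sum_le_sum_step ha hb S
      rw [potential, if_neg (by omega)]
    rw [h0, if_neg hS, sub_zero]
    exact mul_nonneg (by positivity) (potential_nonneg hB H D S)
  have hrS := hrS hS
  rw [if_pos hS]
  have hX : 2 ≤ 2 * (B.card : ℝ) ^ 2 := by nlinarith
  set X := 2 * (B.card : ℝ) ^ 2 with hXdef
  have hθ0 : 0 < 1 / X := by positivity
  have hθ1 : 1 / X ≤ 1 := by
    rw [div_le_one (by positivity)]
    linarith
  set θ := 1 / X with hθ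
  have hXθ : X * θ = 1 := by rw [hθ]; field_simp
  set d := excess B H S with hd
  set u := potential B H D S with hu
  have hθd : θ ^ d ≤ 1 := pow_le_one₀ hθ0.le hθ1
  -- Even a bad choice never raises the excess over `H - 1` unless water is gained, so it costs at
  -- most the rise of the last term to 1.
  have hall : ∀ a ∈ B, ∀ b ∈ B, potential B H D (A.step S a b) ≤ u + θ ^ d := by
    intro a ha b hb
    have hpos : 0 ≤ θ ^ d := by positivity
    rcases step_cases hH hBC hr ha hb hrS with h | ⟨e1, e2, -⟩
    · have := potential_step_of_lt hB H hS h
      rw [← hXdef] at this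
      linarith
    · have h3 := excess_addTwo_le ha hb (fun i => H i - 1) S
      have h4 : (excess B (fun i => H i - 1) (A.step S a b) : ℝ) ≤
          excess B (fun i => H i - 1) S := by exact_mod_cast (by omega)
      rw [potential_step_of_eq H hS e1, ← hXdef, ← hθ, ← hd]
      have h5 : 0 ≤ θ ^ excess B H (A.step S a b) := by positivity
      nlinarith
  obtain ⟨a, ha, b, hb, hgood⟩ := exists_good_step hH hBC hr hrS (by omega)
  have hsplit : ∑ a ∈ B, ∑ b ∈ B, potential B H D (A.step S a b) ≤
      (B.card : ℝ) ^ 2 * (u + θ ^ d) - ((u + θ ^ d) - potential B H D (A.step S a b)) := by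
    rw [← sum_product']
    have hab : (a, b) ∈ B ×ˢ B := mem_product.mpr ⟨ha, hb⟩
    rw [← add_sum_erase _ _ hab]
    have h2 : ∑ x ∈ (B ×ˢ B).erase (a, b), potential B H D (A.step S x.1 x.2) ≤
        ∑ x ∈ (B ×ˢ B).erase (a, b), (u + θ ^ d) :=
      sum_le_sum fun x hx => by
        have := mem_product.mp (mem_of_mem_erase hx)
        exact hall _ this.1 _ this.2
    have h3 : ∑ x ∈ (B ×ˢ B), (u + θ ^ d) = (B.card : ℝ) ^ 2 * (u + θ ^ d) := by
      rw [sum_const, card_product]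
      push_cast [nsmul_eq_mul]
      ring
    rw [← add_sum_erase _ _ hab] at h3
    linarith
  -- The good pair alone must pay for all card² pairs. When only the excess over `H` falls, the
  -- geometric term makes the decrease about `X` times the cost of a bad choice, and `X` is twice
  -- the number of pairs.
  have hcase : potential B H D (A.step S a b) ≤ u - X + 1 ∨
      (potential B H D (A.step S a b) ≤ u + θ ^ d - X * θ ^ d ∧ d ≤ B.card) := by
    rcases hgood with h | ⟨e1, h | ⟨h, hdB⟩⟩
    · left
      exact potential_step_of_lt hB H hS h
    · left
      have h4 : (excess B (fun i => H i - 1) (A.step S a b) : ℝ) + 1 ≤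
          excess B (fun i => H i - 1) S := by exact_mod_cast h
      rw [potential_step_of_eq H hS e1, ← hXdef, ← hθ, ← hd]
      have h5 : 0 ≤ θ ^ excess B H (A.step S a b) := by positivity
      nlinarith
    · right
      refine ⟨?_, hdB⟩
      have h2 := (step_cases hH hBC hr ha hb hrS).resolve_left (by omega)
      have h3 : X * θ ^ d ≤ θ ^ excess B H (A.step S a b) := by
        obtain ⟨e, he⟩ : ∃ e, d = e + 1 := ⟨d - 1, by omega⟩
        rw [he, pow_succ']
        rw [← mul_assoc, hXθ, one_mul]
        exact pow_le_pow_of_le_one hθ0.le hθ1 (by omega)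
      have h4 := excess_addTwo_le ha hb (fun i => H i - 1) S
      have h5 : (excess B (fun i => H i - 1) (A.step S a b) : ℝ) ≤
          excess B (fun i => H i - 1) S := by exact_mod_cast (by omega)
      rw [potential_step_of_eq H hS e1, ← hXdef, ← hθ, ← hd]
      nlinarith
  refine hsplit.trans ?_
  have hθB : θ ^ B.card ≤ 1 := pow_le_one₀ hθ0.le hθ1
  rcases hcase with h | ⟨h, hdB⟩
  · have : ((B.card : ℝ) ^ 2 - 1) * θ ^ d ≤ ((B.card : ℝ) ^ 2 - 1) * 1 :=
      mul_le_mul_of_nonneg_left hθd (by nlinarith)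
    nlinarith
  · have : θ ^ B.card ≤ θ ^ d := pow_le_pow_of_le_one hθ0.le hθ1 hdB
    have h2 : (B.card : ℝ) ^ 2 * θ ^ B.card ≤ (B.card : ℝ) ^ 2 * θ ^ d :=
      mul_le_mul_of_nonneg_left this (by positivity)
    rw [hXdef] at h
    nlinarith

end Emptier

/-! ### Expectations over the filler's choices -/

variable {L : ℕ}

instance (t : Fin (n * L)) : Nonempty (Fin (n - (t.divNat : ℕ))) :=
  ⟨⟨0, Nat.sub_pos_of_lt t.divNat.isLt⟩⟩

theorem card_fuzz_pos : (0 : ℝ) < Fintype.card (Fuzz n L) := by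
  exact_mod_cast Fintype.card_pos

theorem expectation_add (X Y : Fuzz n L → ℝ) :
    expectation (fun ω => X ω + Y ω) = expectation X + expectation Y := by
  simp [expectation, sum_add_distrib, add_div]

theorem expectation_sub (X Y : Fuzz n L → ℝ) :
    expectation (fun ω => X ω - Y ω) = expectation X - expectation Y := by
  simp [expectation, sum_sub_distrib, sub_div]

theorem expectation_const_mul (c : ℝ) (X : Fuzz n L → ℝ) :
    expectation (fun ω => c * X ω) = c * expectation X := by
  simp [expectation, ← mul_sum, mul_div_assoc]

theorem expectation_div_const (X : Fuzz n L → ℝ) (c : ℝ) :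
    expectation (fun ω => X ω / c) = expectation X / c := by
  simp only [expectation, ← sum_div]
  ring

theorem expectation_sum {ι : Type*} (s : Finset ι) (X : ι → Fuzz n L → ℝ) :
    expectation (fun ω => ∑ i ∈ s, X i ω) = ∑ i ∈ s, expectation (X i) := by
  simp only [expectation, ← sum_div]
  rw [sum_comm]

theorem expectation_const (c : ℝ) : expectation (fun _ : Fuzz n L => c) = c := by
  have := card_fuzz_pos (n := n) (L := L)
  simp only [expectation, sum_const, card_univ, nsmul_eq_mul]
  field_simp

theorem expectation_mono {X Y : Fuzz n L → ℝ} (h : ∀ ω, X ω ≤ Y ω) :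
    expectation X ≤ expectation Y :=
  div_le_div_of_nonneg_right (sum_le_sum fun ω _ => h ω) card_fuzz_pos.le

theorem expectation_nonneg {X : Fuzz n L → ℝ} (h : ∀ ω, 0 ≤ X ω) : 0 ≤ expectation X :=
  div_nonneg (sum_nonneg fun ω _ => h ω) card_fuzz_pos.le

theorem abs_expectation_le {X : Fuzz n L → ℝ} {c : ℝ} (h : ∀ ω, |X ω| ≤ c) :
    |expectation X| ≤ c := by
  rw [abs_le]
  refine ⟨?_, ?_⟩
  · rw [← expectation_const (n := n) (L := L) (-c)]
    exact expectation_mono fun ω => (abs_le.mp (h ω)).1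
  · rw [← expectation_const (n := n) (L := L) c]
    exact expectation_mono fun ω => (abs_le.mp (h ω)).2

/-- Averaging over a resampled coordinate does not change the sum. -/
theorem sum_sum_update {ι : Type*} [Fintype ι] [DecidableEq ι] {Z : ι → Type*}
    [∀ i, Fintype (Z i)] (t : ι) (X : (∀ i, Z i) → ℝ) :
    ∑ f, ∑ z : Z t, X (Function.update f t z) = Fintype.card (Z t) * ∑ f, X f := by
  -- Exchanging the coordinate `t` with the fresh sample is an involution.
  let e : (∀ i, Z i) × Z t → (∀ i, Z i) × Z t := fun p => (Function.update p.1 t p.2, p.1 t)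
  have he : Function.Involutive e := by
    rintro ⟨f, z⟩
    simp [e]
  have h1 : ∑ p : (∀ i, Z i) × Z t, X (e p).1 = ∑ p : (∀ i, Z i) × Z t, X p.1 :=
    Equiv.sum_comp he.toPerm (fun p => X p.1)
  rw [Fintype.sum_prod_type, Fintype.sum_prod_type] at h1
  simp only [e] at h1
  rw [h1]
  simp [mul_sum]

theorem expectation_resample (t : Fin (n * L)) (X : Fuzz n L → ℝ) :
    expectation X = expectation (fun ω => (∑ z, X (ω.1, Function.update ω.2 t z)) /
      ((n - (t.divNat : ℕ) : ℕ) : ℝ) ^ 2) := by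
  have hpos : (0 : ℝ) < ((n - (t.divNat : ℕ) : ℕ) : ℝ) := by
    exact_mod_cast Nat.sub_pos_of_lt t.divNat.isLt
  rw [expectation_div_const]
  unfold expectation
  rw [Fintype.sum_prod_type, Fintype.sum_prod_type]
  have h : ∀ π : Equiv.Perm (Fin n), _ = _ := fun π => sum_sum_update t (fun f => X (π, f))
  rw [sum_congr rfl fun π _ => h π, ← mul_sum]
  have hc : (Fintype.card (Fin (n - (t.divNat : ℕ)) × Fin (n - (t.divNat : ℕ))) : ℝ) =
      ((n - (t.divNat : ℕ) : ℕ) : ℝ) ^ 2 := by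
    rw [Fintype.card_prod, Fintype.card_fin]
    push_cast
    ring
  rw [hc]
  field_simp

/-! ### Active cups and the recursion over one step -/

/-- The cups behind the first `m` labels. -/
def active (π : Equiv.Perm (Fin n)) (m : ℕ) : Finset (Fin n) :=
  (univ.filter fun x : Fin n => (x : ℕ) < m).map π.toEmbedding

theorem sum_active {M : Type*} [AddCommMonoid M] (π : Equiv.Perm (Fin n)) (m : ℕ)
    (f : Fin n → M) :
    ∑ i ∈ active π m, f i = ∑ x ∈ univ.filter (fun x : Fin n => (x : ℕ) < m), f (π x) := by
  simp [active]

theorem mem_active {π : Equiv.Perm (Fin n)} {m : ℕ} {x : Fin n} :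
    π x ∈ active π m ↔ (x : ℕ) < m := by
  simp [active]

theorem filter_val_lt_eq {m : ℕ} (hm : m ≤ n) :
    univ.filter (fun x : Fin n => (x : ℕ) < m) =
      (univ : Finset (Fin m)).map (Fin.castLEEmb hm) := by
  ext x
  simp only [mem_filter, mem_univ, true_and, mem_map]
  constructor
  · intro h
    exact ⟨⟨x, h⟩, rfl⟩
  · rintro ⟨y, rfl⟩
    exact y.isLt

theorem card_filter_val_lt {m : ℕ} (hm : m ≤ n) :
    (univ.filter (fun x : Fin n => (x : ℕ) < m)).card = m := by
  rw [filter_val_lt_eq hm]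
  simp

theorem card_active (π : Equiv.Perm (Fin n)) {m : ℕ} (hm : m ≤ n) : (active π m).card = m := by
  rw [active, card_map, card_filter_val_lt hm]

theorem sum_fin_eq_sum_active {M : Type*} [AddCommMonoid M] (π : Equiv.Perm (Fin n)) {m : ℕ}
    (hm : m ≤ n) (f : Fin n → M) :
    ∑ x : Fin m, f (π (Fin.castLE hm x)) = ∑ i ∈ active π m, f i := by
  rw [sum_active, filter_val_lt_eq hm, sum_map]
  rfl

theorem active_succ (π : Equiv.Perm (Fin n)) {j : ℕ} (hj : j < n) :
    active π (j + 1) = insert (π ⟨j, hj⟩) (active π j) := by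
  ext i
  obtain ⟨x, rfl⟩ := π.surjective i
  rw [mem_insert, mem_active, mem_active, π.injective.eq_iff, Fin.ext_iff]
  simp only
  omega

/-- Independence of the steps: `G` may depend on everything except the choice made in step `t`. -/
theorem expectation_step (t : Fin (n * L)) (G : Fuzz n L → Fin n → Fin n → ℝ)
    (hG : ∀ ω z a b, G (ω.1, Function.update ω.2 t z) a b = G ω a b) :
    expectation (fun ω => G ω (cupOf ω t (ω.2 t).1) (cupOf ω t (ω.2 t).2)) =
      expectation (fun ω => (∑ a ∈ active ω.1 (n - (t.divNat : ℕ)),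
        ∑ b ∈ active ω.1 (n - (t.divNat : ℕ)), G ω a b) /
          ((n - (t.divNat : ℕ) : ℕ) : ℝ) ^ 2) := by
  rw [expectation_resample t]
  congr 1
  funext ω
  congr 1
  rw [Fintype.sum_prod_type, ← sum_fin_eq_sum_active ω.1 (Nat.sub_le n (t.divNat : ℕ))]
  refine sum_congr rfl fun x _ => ?_
  rw [← sum_fin_eq_sum_active ω.1 (Nat.sub_le n (t.divNat : ℕ))]
  refine sum_congr rfl fun y _ => ?_
  rw [hG]
  simp [cupOf]

theorem stateAfter_succ (A : Emptier n) (ω : Fuzz n L) (t : Fin (n * L)) :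
    stateAfter A ω (t + 1) =
      A.step (stateAfter A ω t) (cupOf ω t (ω.2 t).1) (cupOf ω t (ω.2 t).2) := by
  rw [stateAfter, dif_pos t.isLt]
  rfl

theorem stateAfter_update (A : Emptier n) (ω : Fuzz n L) (s : Fin (n * L)) (z) {t : ℕ}
    (ht : t ≤ s) : stateAfter A (ω.1, Function.update ω.2 s z) t = stateAfter A ω t := by
  induction t with
  | zero => rfl
  | succ t ih =>
    have hlt : t < n * L := by omega
    rw [stateAfter_succ A _ ⟨t, hlt⟩, stateAfter_succ A _ ⟨t, hlt⟩]
    simp only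
    rw [ih (by omega)]
    have hne : (⟨t, hlt⟩ : Fin (n * L)) ≠ s := by
      intro h
      rw [← h] at ht
      simp at ht
    have hup := Function.update_of_ne hne z ω.2
    simp only [cupOf]
    rw [hup]

/-- The number of active cups in step `t`, which lies in the phase with `m` cups. -/
theorem sub_divNat_eq {m t : ℕ} (hm : m ≤ n) (h1 : (n - m) * L ≤ t)
    (h2 : t < (n - m + 1) * L) (ht : t < n * L) :
    n - ((⟨t, ht⟩ : Fin (n * L)).divNat : ℕ) = m := by
  have : ((⟨t, ht⟩ : Fin (n * L)).divNat : ℕ) = n - m := by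
    rw [Fin.coe_divNat]
    exact Nat.div_eq_of_lt_le h1 h2
  omega

/-! ### Symmetry under exchange of labels -/

/-- Exchanging the labels `x` and `j` in the steps in which both are active. -/
def swapLabels {j : ℕ} (hj : j < n) (x : Fin n) (hx : (x : ℕ) ≤ j) (ω : Fuzz n L) : Fuzz n L :=
  (ω.1 * Equiv.swap x ⟨j, hj⟩, fun t =>
    if h : j < n - (t.divNat : ℕ) then
      (Equiv.swap ⟨x, hx.trans_lt h⟩ ⟨j, h⟩ (ω.2 t).1,
        Equiv.swap ⟨x, hx.trans_lt h⟩ ⟨j, h⟩ (ω.2 t).2)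
    else ω.2 t)

theorem swapLabels_involutive {j : ℕ} (hj : j < n) (x : Fin n) (hx : (x : ℕ) ≤ j) :
    Function.Involutive (swapLabels (L := L) hj x hx) := by
  rintro ⟨π, f⟩
  refine Prod.ext ?_ ?_
  · simp [swapLabels, mul_assoc]
  · funext t
    simp only [swapLabels]
    split_ifs with h
    · simp only [Equiv.swap_apply_self]
    · rfl

theorem expectation_swapLabels {j : ℕ} (hj : j < n) (x : Fin n) (hx : (x : ℕ) ≤ j)
    (X : Fuzz n L → ℝ) :
    expectation (fun ω => X (swapLabels hj x hx ω)) = expectation X := by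
  unfold expectation
  congr 1
  exact Equiv.sum_comp (swapLabels_involutive hj x hx).toPerm X

theorem castLE_swap {m : ℕ} (hm : m ≤ n) (x y z : Fin m) :
    Fin.castLE hm (Equiv.swap x y z) =
      Equiv.swap (Fin.castLE hm x) (Fin.castLE hm y) (Fin.castLE hm z) :=
  ((Fin.castLE_injective hm).swap_apply x y z).symm

theorem cupOf_swapLabels {j : ℕ} (hj : j < n) (x : Fin n) (hx : (x : ℕ) ≤ j) (ω : Fuzz n L)
    (t : Fin (n * L)) (h : j < n - (t.divNat : ℕ)) (y : Fin (n - (t.divNat : ℕ))) :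
    cupOf (swapLabels hj x hx ω) t (Equiv.swap ⟨x, hx.trans_lt h⟩ ⟨j, h⟩ y) = cupOf ω t y := by
  simp only [cupOf, swapLabels, castLE_swap, Equiv.Perm.mul_apply]
  congr 1
  exact Equiv.swap_apply_self _ _ _

/-- Before the phase with `j` cups both labels are active, so exchanging them in the permutation and
in the choices leaves the poured cups unchanged. -/
theorem stateAfter_swapLabels (A : Emptier n) {j : ℕ} (hj : j < n) (x : Fin n)
    (hx : (x : ℕ) ≤ j) (ω : Fuzz n L) {t : ℕ} (ht : t ≤ (n - j) * L) :
    stateAfter A (swapLabels hj x hx ω) t = stateAfter A ω t := by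
  induction t with
  | zero => rfl
  | succ t ih =>
    have hlt : t < n * L := lt_of_lt_of_le (Nat.lt_of_succ_le ht)
      (Nat.mul_le_mul_right L (Nat.sub_le n j))
    have hdiv : j < n - ((⟨t, hlt⟩ : Fin (n * L)).divNat : ℕ) := by
      have : ((⟨t, hlt⟩ : Fin (n * L)).divNat : ℕ) < n - j := by
        rw [Fin.coe_divNat]
        exact Nat.div_lt_of_lt_mul ((Nat.lt_of_succ_le ht).trans_eq (mul_comm _ _))
      omega
    rw [stateAfter_succ A _ ⟨t, hlt⟩, stateAfter_succ A _ ⟨t, hlt⟩]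
    simp only
    rw [ih (by omega)]
    have h1 := cupOf_swapLabels hj x hx ω ⟨t, hlt⟩ hdiv (ω.2 ⟨t, hlt⟩).1
    have h2 := cupOf_swapLabels hj x hx ω ⟨t, hlt⟩ hdiv (ω.2 ⟨t, hlt⟩).2
    rw [← h1, ← h2]
    simp only [swapLabels, dif_pos hdiv]

theorem active_swapLabels {j : ℕ} (hj : j < n) (x : Fin n) (hx : (x : ℕ) ≤ j) (ω : Fuzz n L) :
    active (swapLabels hj x hx ω).1 (j + 1) = active ω.1 (j + 1) := by
  ext i
  obtain ⟨y, rfl⟩ := (ω.1 * Equiv.swap x ⟨j, hj⟩).surjective i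
  have h1 : (ω.1 * Equiv.swap x ⟨j, hj⟩) y ∈ active (swapLabels hj x hx ω).1 (j + 1) ↔
    (y : ℕ) < j + 1 := mem_active
  rw [h1, Equiv.Perm.mul_apply, mem_active]
  rcases eq_or_ne y x with rfl | hyx
  · simp; omega
  · rcases eq_or_ne y ⟨j, hj⟩ with rfl | hyj
    · simp; omega
    · rw [Equiv.swap_apply_of_ne_of_ne hyx hyj]

/-- The cup with label `j` is a uniformly random one among the first `j + 1`, given everything
that is invariant under exchanges of these labels. -/
theorem expectation_last_active {j : ℕ} (hj : j < n) (G : Fuzz n L → Fin n → ℝ)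
    (hG : ∀ (x : Fin n) (hx : (x : ℕ) ≤ j) ω i, G (swapLabels hj x hx ω) i = G ω i) :
    ((j : ℝ) + 1) * expectation (fun ω => G ω (ω.1 ⟨j, hj⟩)) =
      expectation (fun ω => ∑ i ∈ active ω.1 (j + 1), G ω i) := by
  simp only [sum_active]
  rw [expectation_sum]
  have : ∀ x ∈ univ.filter (fun x : Fin n => (x : ℕ) < j + 1),
      expectation (fun ω : Fuzz n L => G ω (ω.1 x)) =
        expectation (fun ω => G ω (ω.1 ⟨j, hj⟩)) := by
    intro x hx
    have hx : (x : ℕ) ≤ j := by simpa [Nat.lt_succ_iff] using hx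
    rw [← expectation_swapLabels hj x hx (fun ω => G ω (ω.1 x))]
    congr 1
    funext ω
    rw [hG]
    simp [swapLabels]
  rw [sum_congr rfl this, sum_const, card_filter_val_lt hj]
  simp

/-! ### Fourier analysis of the parities -/

theorem neg_one_pow_step (A : Emptier n) (S : State n) (a b i : Fin n) :
    (-1 : ℝ) ^ A.step S a b i =
      (-1) ^ S i * (if a = i then -1 else 1) * (if b = i then -1 else 1) := by
  have h1 : (-1 : ℝ) ^ A.step S a b i = (-1) ^ addTwo S a b i := by
    unfold Emptier.step Emptier.move
    split_ifs with h
    · by_cases hi : i = A.select (addTwo S a b)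
      · subst hi
        rw [Function.update_self]
        obtain ⟨c, hc⟩ := Nat.exists_eq_add_of_le h.2
        rw [hc, Nat.add_sub_cancel_left, pow_add]
        norm_num
      · rw [Function.update_of_ne hi]
    · rfl
  rw [h1, addTwo, pow_add, pow_add]
  congr 1
  · congr 1
    split_ifs <;> norm_num
  · split_ifs <;> norm_num

/-- The parity character of the cups behind the labels in `T`. -/
noncomputable def character (T : Finset (Fin n)) (π : Equiv.Perm (Fin n)) (S : State n) : ℝ :=
  ∏ x ∈ T, (-1) ^ S (π x)

theorem abs_character (T : Finset (Fin n)) (π : Equiv.Perm (Fin n)) (S : State n) :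
    |character T π S| = 1 := by
  rw [character, abs_prod]
  exact prod_eq_one fun x _ => by rw [abs_pow, abs_neg, abs_one, one_pow]

theorem prod_ite_eq_map (T : Finset (Fin n)) (π : Equiv.Perm (Fin n)) (a : Fin n) :
    ∏ x ∈ T, (if a = π x then (-1 : ℝ) else 1) =
      if a ∈ T.map π.toEmbedding then -1 else 1 := by
  obtain ⟨y, rfl⟩ := π.surjective a
  simp only [π.injective.eq_iff, prod_ite_eq]
  simp

theorem character_step (A : Emptier n) (T : Finset (Fin n)) (π : Equiv.Perm (Fin n))
    (S : State n) (a b : Fin n) :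
    character T π (A.step S a b) = character T π S *
      ((if a ∈ T.map π.toEmbedding then -1 else 1) *
        (if b ∈ T.map π.toEmbedding then -1 else 1)) := by
  rw [← prod_ite_eq_map, ← prod_ite_eq_map, character, character, ← prod_mul_distrib,
    ← prod_mul_distrib]
  exact prod_congr rfl fun x _ => by rw [neg_one_pow_step, mul_assoc]

theorem sum_sign {π : Equiv.Perm (Fin n)} {m : ℕ} (hm : m ≤ n) {T : Finset (Fin n)}
    (hT : T ⊆ univ.filter fun x : Fin n => (x : ℕ) < m) :
    ∑ a ∈ active π m, (if a ∈ T.map π.toEmbedding then (-1 : ℝ) else 1) = m - 2 * T.card := by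
  have h1 : ∀ a : Fin n, (if a ∈ T.map π.toEmbedding then (-1 : ℝ) else 1) =
      1 - 2 * (if a ∈ T.map π.toEmbedding then 1 else 0) := by
    intro a
    split_ifs <;> norm_num
  have h2 : T.map π.toEmbedding ⊆ active π m := map_subset_map.mpr hT
  simp only [h1]
  rw [sum_sub_distrib, ← mul_sum, sum_boole, sum_const, card_active π hm,
    filter_mem_eq_inter, inter_eq_right.mpr h2, card_map]
  simp

theorem lt_total {m t : ℕ} (hm : 0 < m) (hmn : m ≤ n) (ht : t < L) :
    (n - m) * L + t < n * L :=
  calc (n - m) * L + t < (n - m) * L + L := by omega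
    _ = (n - m + 1) * L := by ring
    _ ≤ n * L := Nat.mul_le_mul_right L (by omega)

theorem active_card_phase {m t : ℕ} (hm : 0 < m) (hmn : m ≤ n) (ht : t < L) :
    n - ((⟨(n - m) * L + t, lt_total hm hmn ht⟩ : Fin (n * L)).divNat : ℕ) = m :=
  sub_divNat_eq hmn (Nat.le_add_right _ _) (by rw [add_mul]; omega) _

/-- The recursion of an expectation over one step of the phase with `m` cups. -/
theorem expectation_step_phase (A : Emptier n) {m t : ℕ} (hm : 0 < m) (hmn : m ≤ n) (ht : t < L)
    (G : Fuzz n L → State n → ℝ)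
    (hG : ∀ (ω : Fuzz n L) (s : Fin (n * L)) z S, (s : ℕ) = (n - m) * L + t →
      G (ω.1, Function.update ω.2 s z) S = G ω S) :
    expectation (fun ω : Fuzz n L => G ω (stateAfter A ω ((n - m) * L + (t + 1)))) =
      expectation (fun ω => (∑ a ∈ active ω.1 m, ∑ b ∈ active ω.1 m,
        G ω (A.step (stateAfter A ω ((n - m) * L + t)) a b)) / (m : ℝ) ^ 2) := by
  set s : Fin (n * L) := ⟨(n - m) * L + t, lt_total hm hmn ht⟩ with hs
  have h1 : ∀ ω : Fuzz n L, stateAfter A ω ((n - m) * L + (t + 1)) =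
      A.step (stateAfter A ω ((n - m) * L + t)) (cupOf ω s (ω.2 s).1) (cupOf ω s (ω.2 s).2) :=
    fun ω => stateAfter_succ A ω s
  simp only [h1]
  rw [expectation_step s (fun ω a b => G ω (A.step (stateAfter A ω ((n - m) * L + t)) a b))]
  · have h2 : n - (s.divNat : ℕ) = m := active_card_phase hm hmn ht
    rw [h2]
  · intro ω z a b
    rw [hG ω s z _ rfl, stateAfter_update A ω s z le_rfl]

/-- Characters are eigenfunctions of the parity walk: each of the two cups drawn in a step
contributes one factor `(m - 2|T|)/m`, whatever the emptier does. -/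
theorem expectation_character (A : Emptier n) {m : ℕ} (hm : 0 < m) (hmn : m ≤ n)
    {T : Finset (Fin n)} (hT : T ⊆ univ.filter fun x : Fin n => (x : ℕ) < m)
    (v : Equiv.Perm (Fin n) → ℝ) {t : ℕ} (ht : t ≤ L) :
    expectation (fun ω : Fuzz n L =>
        v ω.1 * character T ω.1 (stateAfter A ω ((n - m) * L + t))) =
      (((m : ℝ) - 2 * T.card) / m) ^ (2 * t) * expectation (fun ω : Fuzz n L =>
        v ω.1 * character T ω.1 (stateAfter A ω ((n - m) * L))) := by
  induction t with
  | zero => simp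
  | succ t ih =>
    rw [expectation_step_phase A hm hmn (by omega)
      (fun ω S => v ω.1 * character T ω.1 S) (fun _ _ _ _ _ => rfl)]
    have h1 : ∀ ω : Fuzz n L, (∑ a ∈ active ω.1 m, ∑ b ∈ active ω.1 m,
        v ω.1 * character T ω.1 (A.step (stateAfter A ω ((n - m) * L + t)) a b)) /
          (m : ℝ) ^ 2 = (((m : ℝ) - 2 * T.card) / m) ^ 2 *
            (v ω.1 * character T ω.1 (stateAfter A ω ((n - m) * L + t))) := by
      intro ω
      simp only [character_step, ← mul_sum, ← sum_mul]
      rw [sum_sign hmn hT]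
      ring
    simp only [h1]
    rw [expectation_const_mul, ih (by omega), ← mul_assoc]
    congr 1
    ring

/-- The number of cups of `C` in which the parities of `S` and of `H` differ. -/
def mismatch (C : Finset (Fin n)) (H : Fin n → ℕ) (S : State n) : ℕ :=
  (C.filter fun i => S i % 2 ≠ H i % 2).card

/-- The affine function of a sign with values 1 at 1 and 1/4 at -1; expanding the product gives
characters with nonnegative weights, up to signs from `H`. -/
theorem pow_mismatch (C : Finset (Fin n)) (H : Fin n → ℕ) (S : State n) :
    (1 / 4 : ℝ) ^ mismatch C H S = ∏ i ∈ C, (3 / 8 * ((-1) ^ S i * (-1) ^ H i) + 5 / 8) := by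
  rw [mismatch, ← prod_const, prod_filter]
  refine prod_congr rfl fun i _ => ?_
  rw [← pow_add]
  split_ifs with h
  · have : Odd (S i + H i) := by rw [Nat.odd_iff]; omega
    rw [this.neg_one_pow]
    norm_num
  · have : Even (S i + H i) := by rw [Nat.even_iff]; omega
    rw [this.neg_one_pow]
    norm_num

/-- After a phase with `m` cups, the fills of these cups have nearly uniform parities: an
exponential moment of the number of mismatches with any fixed profile. -/
theorem expectation_pow_mismatch_le (A : Emptier n) {m : ℕ} (hm : 2 ≤ m) (hmn : m ≤ n)
    (H : Equiv.Perm (Fin n) → Fin n → ℕ) :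
    expectation (fun ω : Fuzz n L => (1 / 4 : ℝ) ^
        mismatch (active ω.1 m) (H ω.1) (stateAfter A ω ((n - m) * L + L))) ≤
      2 * (5 / 8) ^ m + (1 - 2 / (m : ℝ)) ^ (2 * L) := by
  have hm0 : (2 : ℝ) ≤ m := by exact_mod_cast hm
  set s := univ.filter (fun x : Fin n => (x : ℕ) < m) with hs
  have hcard : s.card = m := card_filter_val_lt hmn
  set ε := (1 - 2 / (m : ℝ)) ^ (2 * L) with hε
  have hε0 : 0 ≤ ε := by
    apply pow_nonneg
    rw [sub_nonneg, div_le_one (by linarith)]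
    exact hm0
  have hexp : ∀ ω : Fuzz n L, (1 / 4 : ℝ) ^
      mismatch (active ω.1 m) (H ω.1) (stateAfter A ω ((n - m) * L + L)) =
        ∑ T ∈ s.powerset, ((3 / 8 : ℝ) ^ T.card * (5 / 8) ^ (s.card - T.card)) *
          ((∏ x ∈ T, (-1 : ℝ) ^ H ω.1 (ω.1 x)) *
            character T ω.1 (stateAfter A ω ((n - m) * L + L))) := by
    intro ω
    rw [pow_mismatch, active, prod_map, ← hs, prod_add]
    refine sum_congr rfl fun T hT => ?_
    rw [prod_const, card_sdiff_of_subset (mem_powerset.mp hT), prod_mul_distrib, prod_const,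
      prod_mul_distrib]
    simp only [character, Equiv.coe_toEmbedding]
    ring
  simp only [hexp]
  rw [expectation_sum]
  -- Only the empty set and the full set (the total parity) do not decay, and each has weight at
  -- most `(5/8)^m`. All other eigenvalues are at most `(1 - 2/m)^2` per step, and the weights sum
  -- to `(3/8 + 5/8)^m = 1`.
  have hterm : ∀ T ∈ s.powerset, expectation (fun ω : Fuzz n L =>
      ((3 / 8 : ℝ) ^ T.card * (5 / 8) ^ (s.card - T.card)) *
          ((∏ x ∈ T, (-1 : ℝ) ^ H ω.1 (ω.1 x)) *
            character T ω.1 (stateAfter A ω ((n - m) * L + L)))) ≤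
      ((3 / 8 : ℝ) ^ T.card * (5 / 8) ^ (s.card - T.card)) * ε +
        ((if T = ∅ then (5 / 8) ^ m else 0) + (if T = s then (5 / 8) ^ m else 0)) := by
    intro T hT
    rw [mem_powerset] at hT
    rw [expectation_const_mul, expectation_character A (by omega) hmn hT
      (fun π => ∏ x ∈ T, (-1 : ℝ) ^ H π (π x)) le_rfl]
    set E := expectation (fun ω : Fuzz n L => (∏ x ∈ T, (-1 : ℝ) ^ H ω.1 (ω.1 x)) *
      character T ω.1 (stateAfter A ω ((n - m) * L))) with hE
    have hE1 : E ≤ 1 := by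
      refine (le_abs_self _).trans (abs_expectation_le fun ω => ?_)
      rw [abs_mul, abs_character, abs_prod]
      refine (mul_one _).trans_le (prod_eq_one fun x _ => ?_).le
      rw [abs_pow, abs_neg, abs_one, one_pow]
    have hTm : T.card ≤ m := hcard ▸ card_le_card hT
    have hTm' : (T.card : ℝ) ≤ m := by exact_mod_cast hTm
    set lam := ((m : ℝ) - 2 * T.card) / m with hlam
    have hsq : lam ^ (2 * L) = (lam ^ 2) ^ L := pow_mul _ _ _
    have hlamE : lam ^ (2 * L) * E ≤ lam ^ (2 * L) := by
      apply mul_le_of_le_one_right _ hE1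
      rw [hsq]
      positivity
    have hw : (0 : ℝ) ≤ (3 / 8 : ℝ) ^ T.card * (5 / 8) ^ (s.card - T.card) := by positivity
    have hlam1 : lam ^ (2 * L) ≤ 1 := by
      rw [hsq]
      apply pow_le_one₀ (sq_nonneg _)
      rw [sq_le_one_iff_abs_le_one, abs_le, hlam]
      constructor
      · rw [le_div_iff₀ (by linarith)]
        linarith
      · rw [div_le_one (by linarith)]
        have : (0 : ℝ) ≤ T.card := by positivity
        linarith
    by_cases h0 : T = ∅
    · have h1 : (0 : ℝ) ≤ if T = s then (5 / 8 : ℝ) ^ m else 0 := by split_ifs <;> positivity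
      have h2 : (3 / 8 : ℝ) ^ T.card * (5 / 8) ^ (s.card - T.card) = (5 / 8) ^ m := by
        rw [h0, hcard]
        simp
      rw [h2] at hw ⊢
      rw [if_pos h0]
      nlinarith
    · by_cases h1 : T = s
      · have h2 : (3 / 8 : ℝ) ^ T.card * (5 / 8) ^ (s.card - T.card) ≤ (5 / 8) ^ m := by
          rw [h1, hcard]
          simpa using pow_le_pow_left₀ (by norm_num) (by norm_num : (3 / 8 : ℝ) ≤ 5 / 8) m
        rw [if_neg h0, if_pos h1]
        nlinarith
      · rw [if_neg h0, if_neg h1, add_zero, add_zero]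
        apply mul_le_mul_of_nonneg_left _ hw
        refine hlamE.trans ?_
        have hc1 : 1 ≤ T.card := card_pos.mpr (nonempty_iff_ne_empty.mpr h0)
        have hc2 : T.card + 1 ≤ m := by
          rw [← hcard]
          exact card_lt_card (hT.ssubset_of_ne h1)
        have hc1' : (1 : ℝ) ≤ T.card := by exact_mod_cast hc1
        have hc2' : (T.card : ℝ) + 1 ≤ m := by exact_mod_cast hc2
        rw [hε, hsq, pow_mul]
        apply pow_le_pow_left₀ (sq_nonneg _)
        rw [hlam]
        have : 1 - 2 / (m : ℝ) = (m - 2) / m := by field_simp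
        rw [this, div_pow, div_pow]
        apply div_le_div_of_nonneg_right _ (sq_nonneg _)
        nlinarith
  refine (sum_le_sum hterm).trans ?_
  rw [sum_add_distrib, sum_add_distrib, ← sum_mul, sum_pow_mul_eq_add_pow, sum_ite_eq',
    sum_ite_eq', if_pos (empty_mem_powerset s), if_pos (mem_powerset_self s)]
  norm_num
  linarith

/-! ### Overflow of the dropped cup and gain of the active cups -/

open Classical in
/-- A threshold profile on `C` of total size `m`, if there is one. -/
noncomputable def Emptier.threshold (A : Emptier n) (C : Finset (Fin n)) (m : ℕ) : Fin n → ℕ :=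
  if h : ∃ H : Fin n → ℕ, A.IsThreshold C H ∧ ∑ i ∈ C, H i = m then h.choose else 0

theorem Emptier.threshold_spec {A : Emptier n} (hA : A.IsScoreBased ∨ A.IsMonotone)
    {C : Finset (Fin n)} (hC : C.Nonempty) (m : ℕ) :
    A.IsThreshold C (A.threshold C m) ∧ ∑ i ∈ C, A.threshold C m i = m := by
  have h := Emptier.exists_isThreshold hA hC m
  rw [Emptier.threshold, dif_pos h]
  exact h.choose_spec

/-- The threshold profile used in the state `S`: it leaves room for one more unit. -/
noncomputable def Emptier.profile (A : Emptier n) (C : Finset (Fin n)) (S : State n) :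
    Fin n → ℕ :=
  A.threshold C (∑ i ∈ C, S i + 2)

theorem cupOf_mem_active (ω : Fuzz n L) (t : Fin (n * L)) (x : Fin (n - (t.divNat : ℕ))) :
    cupOf ω t x ∈ active ω.1 (n - (t.divNat : ℕ)) := by
  rw [cupOf, mem_active]
  exact x.isLt

/-- The two half-units poured always land in `E`, and at most two leave it. `E` may also contain the
dropped cup. -/
theorem sum_le_sum_stateAfter (A : Emptier n) (ω : Fuzz n L) {j : ℕ} (hj : 0 < j) (hjn : j ≤ n)
    {E : Finset (Fin n)} (hE : active ω.1 j ⊆ E) {t t' : ℕ} (htt : t ≤ t') (ht : t' ≤ L) :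
    ∑ i ∈ E, stateAfter A ω ((n - j) * L + t) i ≤
      ∑ i ∈ E, stateAfter A ω ((n - j) * L + t') i := by
  induction t', htt using Nat.le_induction with
  | base => exact le_rfl
  | succ t' _ ih =>
    refine (ih (by omega)).trans ?_
    have hlt : t' < L := by omega
    set s : Fin (n * L) := ⟨(n - j) * L + t', lt_total hj hjn hlt⟩ with hs
    have h1 : stateAfter A ω ((n - j) * L + (t' + 1)) =
      A.step (stateAfter A ω ((n - j) * L + t')) (cupOf ω s (ω.2 s).1) (cupOf ω s (ω.2 s).2) :=
      stateAfter_succ A ω s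
    have h2 : n - (s.divNat : ℕ) = j := active_card_phase hj hjn hlt
    have hmem : ∀ x, cupOf ω s x ∈ E := fun x => hE (by
      have := cupOf_mem_active ω s x
      rwa [h2] at this)
    rw [h1]
    exact A.sum_le_sum_step (hmem _) (hmem _) _

/-- The increase of the water in the first `j` cups during the phase with `j` cups. -/
noncomputable def gain (A : Emptier n) (j : ℕ) (ω : Fuzz n L) : ℝ :=
  (∑ i ∈ active ω.1 j, stateAfter A ω ((n - j) * L + L) i : ℕ) -
    (∑ i ∈ active ω.1 j, stateAfter A ω ((n - j) * L) i : ℕ)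

theorem gain_nonneg (A : Emptier n) {j : ℕ} (hj : 0 < j) (hjn : j ≤ n) (ω : Fuzz n L) :
    0 ≤ gain A j ω := by
  rw [gain, sub_nonneg]
  exact_mod_cast sum_le_sum_stateAfter A ω hj hjn subset_rfl (Nat.zero_le L) le_rfl

/-- The amount by which the cup `i` exceeds the profile at the beginning of the phase with
`j` cups, where the profile refers to the cups of the previous phase. -/
noncomputable def overflow (A : Emptier n) (j : ℕ) (ω : Fuzz n L) (i : Fin n) : ℕ :=
  stateAfter A ω ((n - j) * L) i -
    A.profile (active ω.1 (j + 1)) (stateAfter A ω ((n - j) * L)) i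

theorem sum_active_succ (ω : Fuzz n L) {j : ℕ} (hj : j < n) (S : State n) :
    ∑ i ∈ active ω.1 (j + 1), S i = S (ω.1 ⟨j, hj⟩) + ∑ i ∈ active ω.1 j, S i := by
  rw [active_succ _ hj, sum_insert]
  rw [mem_active]
  simp

/-- In a long phase, the water in the active cups increases by the overflow of the cup that has
just been dropped, except on an event of small probability. -/
theorem expectation_overflow_le {A : Emptier n} (hA : A.IsScoreBased ∨ A.IsMonotone) {j : ℕ}
    (hj : 0 < j) (hjn : j < n) (hL : 0 < L) {M : ℕ} {f f' : Fuzz n L → ℝ}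
    (hf0 : ∀ ω, 0 ≤ f' ω) (hff : ∀ ω, f' ω ≤ f ω) (hf1 : ∀ ω, f ω ≤ 1)
    (hf : ∀ (ω : Fuzz n L) (s : Fin (n * L)) z, (n - j) * L ≤ s →
      f (ω.1, Function.update ω.2 s z) = f ω)
    (hM : ∀ ω, f ω ≠ 0 → ∑ i ∈ active ω.1 (j + 1), stateAfter A ω ((n - j) * L) i ≤ M) :
    expectation (fun ω => f' ω * overflow A j ω (ω.1 ⟨j, hjn⟩)) ≤
      expectation (fun ω => f' ω * gain A j ω) +
        M * ((2 * (j : ℝ) ^ 2 * (M + 2) ^ 2) * (2 * (j : ℝ) ^ 2) ^ j / L) := by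
  have hf0' : ∀ ω, 0 ≤ f ω := fun ω => (hf0 ω).trans (hff ω)
  set S : Fuzz n L → ℕ → State n := fun ω t => stateAfter A ω ((n - j) * L + t) with hS
  set B : Fuzz n L → Finset (Fin n) := fun ω => active ω.1 j with hB
  set H : Fuzz n L → Fin n → ℕ := fun ω => A.profile (active ω.1 (j + 1)) (S ω 0) with hH
  set o : Fuzz n L → ℕ := fun ω => overflow A j ω (ω.1 ⟨j, hjn⟩) with ho
  have ho' : ∀ ω, o ω = S ω 0 (ω.1 ⟨j, hjn⟩) - H ω (ω.1 ⟨j, hjn⟩) := fun ω => rfl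
  -- If the overflow is positive, the thresholds of `B` sum to exactly `D + 2`: the room that the
  -- drift needs.
  set D : Fuzz n L → ℕ := fun ω => ∑ i ∈ B ω, S ω 0 i + o ω with hD
  have hBcard : ∀ ω, ((B ω).card : ℝ) = j := fun ω => by
    exact_mod_cast card_active ω.1 hjn.le
  have hBne : ∀ ω, (B ω).Nonempty := fun ω => by
    rw [← card_pos, card_active ω.1 hjn.le]
    exact hj
  have hBC : ∀ ω, B ω ⊆ active ω.1 (j + 1) := fun ω => by
    rw [active_succ _ hjn]
    exact subset_insert _ _
  have hrC : ∀ ω : Fuzz n L, ω.1 ⟨j, hjn⟩ ∈ active ω.1 (j + 1) := fun ω => by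
    rw [mem_active]
    simp
  have hthr : ∀ ω, A.IsThreshold (active ω.1 (j + 1)) (H ω) ∧
      ∑ i ∈ active ω.1 (j + 1), H ω i = ∑ i ∈ active ω.1 (j + 1), S ω 0 i + 2 := fun ω =>
    Emptier.threshold_spec hA ⟨_, hrC ω⟩ _
  have hmonoB : ∀ ω t t', t ≤ t' → t' ≤ L → ∑ i ∈ B ω, S ω t i ≤ ∑ i ∈ B ω, S ω t' i :=
    fun ω t t' h h' => sum_le_sum_stateAfter A ω hj hjn.le subset_rfl h h'
  have hmonoC : ∀ ω t, t ≤ L → ∑ i ∈ active ω.1 (j + 1), S ω 0 i ≤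
      ∑ i ∈ active ω.1 (j + 1), S ω t i :=
    fun ω t h => sum_le_sum_stateAfter A ω hj hjn.le (hBC ω) (Nat.zero_le t) h
  have hDM : ∀ ω, f ω ≠ 0 → D ω ≤ M := fun ω h => by
    refine le_trans ?_ (hM ω h)
    rw [sum_active_succ ω hjn]
    simp only [hD, ho', hB]
    have : S ω 0 = stateAfter A ω ((n - j) * L) := rfl
    rw [this]
    omega
  set δ : ℝ := (1 / (2 * (j : ℝ) ^ 2)) ^ j with hδ
  have hj1 : (1 : ℝ) ≤ j := by exact_mod_cast hj
  have hδ0 : 0 < δ := by positivity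
  -- the drift of the potential in one step
  have hdrift : ∀ t < L, expectation (fun ω => f ω * potential (B ω) (H ω) (D ω) (S ω (t + 1))) ≤
      expectation (fun ω => f ω * potential (B ω) (H ω) (D ω) (S ω t)) -
        δ * expectation (fun ω => f ω * if ∑ i ∈ B ω, S ω t i < D ω then 1 else 0) := by
    intro t ht
    rw [expectation_step_phase A hj hjn.le ht
      (fun ω T => f ω * potential (B ω) (H ω) (D ω) T), ← expectation_const_mul,
      ← expectation_sub]
    · apply expectation_mono
      intro ω
      have key : ∑ a ∈ B ω, ∑ b ∈ B ω, potential (B ω) (H ω) (D ω) (A.step (S ω t) a b) ≤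
          (j : ℝ) ^ 2 * (potential (B ω) (H ω) (D ω) (S ω t) -
            if ∑ i ∈ B ω, S ω t i < D ω then δ else 0) := by
        -- Without overflow the dropped cup need not exceed its threshold and nothing is claimed:
        -- the water is at least `D` from the start and the potential vanishes.
        by_cases ho0 : o ω = 0
        · have h0 : ∑ i ∈ B ω, S ω 0 i ≤ ∑ i ∈ B ω, S ω t i := hmonoB ω 0 t (Nat.zero_le t) ht.le
          have hDe : D ω = ∑ i ∈ B ω, S ω 0 i := by simp only [hD, ho0, add_zero]
          rw [if_neg (by omega)]
          rw [potential, if_neg (by omega), sub_zero, mul_zero]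
          apply le_of_eq
          refine sum_eq_zero fun a ha => sum_eq_zero fun b hb => ?_
          have := A.sum_le_sum_step ha hb (S ω t)
          rw [potential, if_neg (by omega)]
        · have h1 := (hthr ω).2
          rw [sum_active_succ ω hjn, sum_active_succ ω hjn] at h1
          have h2 := hmonoC ω t ht.le
          rw [sum_active_succ ω hjn, sum_active_succ ω hjn] at h2
          have h3 := ho' ω
          have h4 : D ω = ∑ i ∈ B ω, S ω 0 i + o ω := rfl
          simp only [hB] at h4
          -- The dropped cup stays above its threshold while the water in `B` is below `D`, because
          -- the water in `B` and this cup together never decreases.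
          have := Emptier.sum_potential_step_le (hBne ω) (hthr ω).1 (hBC ω) (hrC ω)
            (D := D ω) (S := S ω t) (by simp only [hB]; omega) (by simp only [hB]; omega)
          rwa [hBcard, card_active ω.1 hjn.le] at this
      have hj2 : (0 : ℝ) < (j : ℝ) ^ 2 := by positivity
      have key2 : (∑ a ∈ B ω, ∑ b ∈ B ω,
          f ω * potential (B ω) (H ω) (D ω) (A.step (S ω t) a b)) / (j : ℝ) ^ 2 ≤
          f ω * (potential (B ω) (H ω) (D ω) (S ω t) -
            if ∑ i ∈ B ω, S ω t i < D ω then δ else 0) := by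
        simp only [← mul_sum]
        rw [mul_div_assoc]
        apply mul_le_mul_of_nonneg_left _ (hf0' ω)
        rw [div_le_iff₀ hj2]
        linarith
      refine key2.trans (le_of_eq ?_)
      split_ifs <;> ring
    · intro ω s z T hs
      have h0 : S (ω.1, Function.update ω.2 s z) 0 = S ω 0 :=
        stateAfter_update A ω s z (by omega)
      have h1 : H (ω.1, Function.update ω.2 s z) = H ω := by simp only [hH, h0]
      have h2 : D (ω.1, Function.update ω.2 s z) = D ω := by
        simp only [hD, ho', h0, h1, hB]
      simp only [h1, h2, hf ω s z (by omega), hB]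
  set p := expectation (fun ω => f ω * if ∑ i ∈ B ω, S ω L i < D ω then 1 else 0) with hp
  have htele : ∀ t ≤ L, expectation (fun ω => f ω * potential (B ω) (H ω) (D ω) (S ω t)) ≤
      expectation (fun ω => f ω * potential (B ω) (H ω) (D ω) (S ω 0)) - t * (δ * p) := by
    intro t ht
    induction t with
    | zero => simp
    | succ t ih =>
      have h1 := hdrift t (by omega)
      have h2 := ih (by omega)
      have h3 : p ≤ expectation
          (fun ω => f ω * if ∑ i ∈ B ω, S ω t i < D ω then 1 else 0) := by
        apply expectation_mono
        intro ω
        apply mul_le_mul_of_nonneg_left _ (hf0' ω)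
        have := hmonoB ω t L (by omega) le_rfl
        split_ifs <;> first | omega | norm_num
      have h4 := mul_le_mul_of_nonneg_left h3 hδ0.le
      push_cast
      linarith
  have hL' : (0 : ℝ) < L := by exact_mod_cast hL
  have hinit : expectation (fun ω => f ω * potential (B ω) (H ω) (D ω) (S ω 0)) ≤
      2 * (j : ℝ) ^ 2 * (M + 2) ^ 2 := by
    rw [← expectation_const (n := n) (L := L) (2 * (j : ℝ) ^ 2 * (M + 2) ^ 2)]
    apply expectation_mono
    intro ω
    by_cases h0 : f ω = 0
    · rw [h0, zero_mul]
      positivity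
    · have h1 := potential_le (hBne ω) (H ω) (D ω) (S ω 0)
      rw [hBcard] at h1
      have h2 : (D ω : ℝ) ≤ M := by exact_mod_cast hDM ω h0
      have h3 : 2 * (j : ℝ) ^ 2 * ((D ω : ℝ) + 2) ^ 2 ≤ 2 * (j : ℝ) ^ 2 * (M + 2) ^ 2 := by
        gcongr
      have h4 := potential_nonneg (hBne ω) (H ω) (D ω) (S ω 0)
      exact (mul_le_of_le_one_left h4 (hf1 ω)).trans (h1.trans h3)
  have hfinal : 0 ≤ expectation (fun ω => f ω * potential (B ω) (H ω) (D ω) (S ω L)) :=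
    expectation_nonneg fun ω => mul_nonneg (hf0' ω) (potential_nonneg (hBne ω) _ _ _)
  have hpb : p ≤ (2 * (j : ℝ) ^ 2 * (M + 2) ^ 2) * (2 * (j : ℝ) ^ 2) ^ j / L := by
    have h1 := htele L le_rfl
    have h2 : L * (δ * p) ≤ 2 * (j : ℝ) ^ 2 * (M + 2) ^ 2 := by linarith
    have h3 : δ * (2 * (j : ℝ) ^ 2) ^ j = 1 := by
      rw [hδ, ← mul_pow, one_div_mul_cancel (by positivity), one_pow]
    rw [le_div_iff₀ hL']
    have h4 := mul_le_mul_of_nonneg_right h2 (by positivity : 0 ≤ (2 * (j : ℝ) ^ 2) ^ j)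
    calc p * L = L * (δ * p) * (2 * (j : ℝ) ^ 2) ^ j := by
          linear_combination (-(p * L)) * h3
      _ ≤ _ := h4
  have hpt : expectation (fun ω => f' ω * o ω) ≤ expectation (fun ω => f' ω * gain A j ω +
      M * (f ω * if ∑ i ∈ B ω, S ω L i < D ω then 1 else 0)) := by
    apply expectation_mono
    intro ω
    have hg : gain A j ω = (∑ i ∈ B ω, S ω L i : ℕ) - (∑ i ∈ B ω, S ω 0 i : ℕ) := rfl
    have hgn := gain_nonneg A hj hjn.le ω
    by_cases h : ∑ i ∈ B ω, S ω L i < D ω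
    · rw [if_pos h, mul_one]
      by_cases h0 : f ω = 0
      · have : f' ω = 0 := le_antisymm (h0 ▸ hff ω) (hf0 ω)
        rw [h0, this]
        simp
      · have h1 : (o ω : ℝ) ≤ M := by
          have h2 := hDM ω h0
          have h3 : D ω = ∑ i ∈ B ω, S ω 0 i + o ω := rfl
          exact_mod_cast (by omega : o ω ≤ M)
        have h2 : f' ω * o ω ≤ f ω * M := mul_le_mul (hff ω) h1 (by positivity) (hf0' ω)
        have h3 := mul_nonneg (hf0 ω) hgn
        linarith
    · rw [if_neg h, mul_zero, mul_zero, add_zero]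
      apply mul_le_mul_of_nonneg_left _ (hf0 ω)
      push Not at h
      have h3 : ∑ i ∈ B ω, S ω 0 i + o ω ≤ ∑ i ∈ B ω, S ω L i := h
      have h4 : ((∑ i ∈ B ω, S ω 0 i : ℕ) : ℝ) + o ω ≤ (∑ i ∈ B ω, S ω L i : ℕ) := by
        exact_mod_cast h3
      rw [hg]
      linarith
  rw [expectation_add, expectation_const_mul] at hpt
  refine hpt.trans ?_
  gcongr

/-- Exceeding and missing the profile both account for the parity mismatches. -/
theorem mismatch_le {C : Finset (Fin n)} {H : Fin n → ℕ} {S : State n}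
    (h : ∑ i ∈ C, H i = ∑ i ∈ C, S i + 2) :
    mismatch C H S ≤ 2 * ∑ i ∈ C, (S i - H i) + 2 := by
  have h1 : mismatch C H S ≤ ∑ i ∈ C, ((S i - H i) + (H i - S i)) := by
    rw [mismatch, card_filter]
    apply sum_le_sum
    intro i _
    split_ifs with hi
    · omega
    · omega
  have h2 : ∑ i ∈ C, (H i - S i) + ∑ i ∈ C, S i = ∑ i ∈ C, (S i - H i) + ∑ i ∈ C, H i := by
    rw [← sum_add_distrib, ← sum_add_distrib]
    apply sum_congr rfl
    intro i _
    omega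
  rw [sum_add_distrib] at h1
  omega

/-- The bound on the probability of few parity mismatches with one of `M + 1` profiles. -/
noncomputable def parityError (M m L : ℕ) : ℝ :=
  (M + 1) * ((6 / 5) ^ m * (2 * (5 / 8) ^ m + (1 - 2 / (m : ℝ)) ^ (2 * L)))

theorem six_fifths_pow_le {m Q : ℕ} (h : 8 * Q < m) :
    1 ≤ (6 / 5 : ℝ) ^ m * (1 / 4) ^ Q := by
  have h1 : (6 / 5 : ℝ) ^ (8 * Q) ≤ (6 / 5) ^ m := pow_le_pow_right₀ (by norm_num) h.le
  have h2 : (1 : ℝ) ≤ (6 / 5 : ℝ) ^ (8 * Q) * (1 / 4) ^ Q := by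
    rw [pow_mul, ← mul_pow]
    exact one_le_pow₀ (by norm_num)
  exact h2.trans (mul_le_mul_of_nonneg_right h1 (by positivity))

theorem phase_end_eq {j : ℕ} (hjn : j < n) : (n - (j + 1)) * L + L = (n - j) * L := by
  have : n - j = n - (j + 1) + 1 := by omega
  rw [this]
  ring

/-- After a phase the cups exceed the profile by a constant amount on average. -/
theorem le_expectation_sum_overflow {A : Emptier n} (hA : A.IsScoreBased ∨ A.IsMonotone) {j : ℕ}
    (hj : 0 < j) (hjn : j < n) {M : ℕ} {f : Fuzz n L → ℝ}
    (hf0 : ∀ ω, 0 ≤ f ω) (hf1 : ∀ ω, f ω ≤ 1)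
    (hM : ∀ ω, f ω ≠ 0 → ∑ i ∈ active ω.1 (j + 1), stateAfter A ω ((n - j) * L) i ≤ M) :
    ((j : ℝ) + 1) / 16 * (expectation f - parityError M (j + 1) L) - 1 ≤
      expectation (fun ω => ∑ i ∈ active ω.1 (j + 1), f ω * overflow A j ω i) := by
  set S : Fuzz n L → State n := fun ω => stateAfter A ω ((n - j) * L) with hS
  set C : Fuzz n L → Finset (Fin n) := fun ω => active ω.1 (j + 1) with hC
  -- The profile in use depends on the random total of water, whereas the parity bound needs one
  -- fixed in advance. Hence a union bound over all totals up to `M`.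
  set Q : Fuzz n L → ℕ → ℕ := fun ω m => mismatch (C ω) (A.threshold (C ω) (m + 2)) (S ω) with hQ
  set E : Fuzz n L → ℝ := fun ω => ∑ m ∈ range (M + 1), (6 / 5 : ℝ) ^ (j + 1) * (1 / 4) ^ Q ω m
    with hE
  have hEb : expectation E ≤ parityError M (j + 1) L := by
    simp only [hE]
    rw [expectation_sum]
    have h1 : ∀ m ∈ range (M + 1),
        expectation (fun ω : Fuzz n L => (6 / 5 : ℝ) ^ (j + 1) * (1 / 4) ^ Q ω m) ≤
          (6 / 5) ^ (j + 1) * (2 * (5 / 8) ^ (j + 1) + (1 - 2 / ((j + 1 : ℕ) : ℝ)) ^ (2 * L)) := by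
      intro m _
      rw [expectation_const_mul]
      apply mul_le_mul_of_nonneg_left _ (by positivity)
      have := expectation_pow_mismatch_le (L := L) A (show 2 ≤ j + 1 by omega) hjn
        (fun π => A.threshold (active π (j + 1)) (m + 2))
      rw [phase_end_eq hjn] at this
      exact this
    refine (sum_le_sum h1).trans (le_of_eq ?_)
    rw [sum_const, card_range, parityError, nsmul_eq_mul]
    push_cast
    ring
  have hpt : ∀ ω, ((j : ℝ) + 1) / 16 * (f ω - E ω) - 1 ≤
      ∑ i ∈ C ω, f ω * overflow A j ω i := by
    intro ω
    rw [← mul_sum]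
    have hE0 : 0 ≤ E ω := sum_nonneg fun m _ => by positivity
    have hj0 : (0 : ℝ) ≤ j := by positivity
    by_cases h0 : f ω = 0
    · rw [h0, zero_mul]
      nlinarith
    · have hW := hM ω h0
      set W := ∑ i ∈ C ω, S ω i with hWdef
      have hne : (C ω).Nonempty := ⟨ω.1 ⟨j, hjn⟩, by simp only [hC]; rw [mem_active]; simp⟩
      have hmis := mismatch_le (Emptier.threshold_spec hA hne (W + 2)).2
      have hsum : ∑ i ∈ C ω, (overflow A j ω i : ℝ) =
          ((∑ i ∈ C ω, (S ω i - A.threshold (C ω) (W + 2) i) : ℕ) : ℝ) := by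
        push_cast [overflow]
        rfl
      rw [hsum]
      set O := ∑ i ∈ C ω, (S ω i - A.threshold (C ω) (W + 2) i) with hO
      have hO0 : (0 : ℝ) ≤ O := by positivity
      -- Few mismatches make `E` at least 1 and the claim trivial; otherwise `mismatch_le` yields
      -- overflow at least `(j + 1)/16 - 1`.
      by_cases hq : 8 * Q ω W < j + 1
      · have h1 : 1 ≤ E ω := by
          refine (six_fifths_pow_le hq).trans ?_
          exact single_le_sum (f := fun m => (6 / 5 : ℝ) ^ (j + 1) * (1 / 4) ^ Q ω m)
            (fun m _ => by positivity) (mem_range.mpr (Nat.lt_succ_of_le hW))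
        have h2 := mul_nonneg (hf0 ω) hO0
        have h3 := hf1 ω
        nlinarith
      · have h1 : j + 1 ≤ 8 * (2 * O + 2) := by
          have : Q ω W ≤ 2 * O + 2 := hmis
          omega
        have h2 : (j : ℝ) + 1 ≤ 8 * (2 * O + 2) := by exact_mod_cast h1
        have h3 := hf1 ω
        have h4 := hf0 ω
        have h5 : f ω * ((j + 1) / 16 - 1) ≤ f ω * O := mul_le_mul_of_nonneg_left (by linarith) h4
        nlinarith
  have h1 := expectation_mono hpt
  rw [expectation_sub, expectation_const_mul, expectation_sub, expectation_const] at h1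
  have h2 : ((j : ℝ) + 1) / 16 * expectation E ≤ ((j : ℝ) + 1) / 16 * parityError M (j + 1) L :=
    mul_le_mul_of_nonneg_left hEb (by positivity)
  linarith

theorem overflow_swapLabels (A : Emptier n) {j : ℕ} (hj : j < n) (x : Fin n) (hx : (x : ℕ) ≤ j)
    (ω : Fuzz n L) (i : Fin n) : overflow A j (swapLabels hj x hx ω) i = overflow A j ω i := by
  rw [overflow, overflow, stateAfter_swapLabels A hj x hx ω le_rfl, active_swapLabels]

/-- The water of the active cups increases by a constant amount in every phase. -/
theorem le_expectation_gain {A : Emptier n} (hA : A.IsScoreBased ∨ A.IsMonotone) {j : ℕ}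
    (hj : 0 < j) (hjn : j < n) (hL : 0 < L) {M : ℕ} {c : ℝ} {f f' : Fuzz n L → ℝ}
    (hf0 : ∀ ω, 0 ≤ f' ω) (hff : ∀ ω, f' ω ≤ f ω) (hf1 : ∀ ω, f ω ≤ 1)
    (hf : ∀ (ω : Fuzz n L) (s : Fin (n * L)) z, (n - j) * L ≤ s →
      f (ω.1, Function.update ω.2 s z) = f ω)
    (hswap : ∀ (x : Fin n) (hx : (x : ℕ) ≤ j) ω, f (swapLabels hjn x hx ω) = f ω)
    (hM : ∀ ω, f ω ≠ 0 → ∑ i ∈ active ω.1 (j + 1), stateAfter A ω ((n - j) * L) i ≤ M)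
    (hc : ∀ ω, f ω ≠ 0 → (stateAfter A ω ((n - j) * L) (ω.1 ⟨j, hjn⟩) : ℝ) ≤ c) :
    (expectation f - parityError M (j + 1) L) / 16 - 1 / ((j : ℝ) + 1) -
        M * ((2 * (j : ℝ) ^ 2 * (M + 2) ^ 2) * (2 * (j : ℝ) ^ 2) ^ j / L) -
        c * (expectation f - expectation f') ≤
      expectation (fun ω => f' ω * gain A j ω) := by
  have h1 := expectation_overflow_le hA hj hjn hL hf0 hff hf1 hf hM
  have h2 := le_expectation_sum_overflow (L := L) hA hj hjn
    (fun ω => (hf0 ω).trans (hff ω)) hf1 hM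
  rw [← expectation_last_active hjn (fun ω i => f ω * overflow A j ω i) (by
    intro x hx ω i
    rw [hswap, overflow_swapLabels])] at h2
  -- The symmetry argument needs the weight `f`, which ignores the current phase; `f'` may depend on
  -- it, at a price of `c` per unit of lost weight.
  have h3 : expectation (fun ω => f ω * overflow A j ω (ω.1 ⟨j, hjn⟩)) -
      expectation (fun ω => f' ω * overflow A j ω (ω.1 ⟨j, hjn⟩)) ≤
      c * (expectation f - expectation f') := by
    rw [← expectation_sub, ← expectation_sub, ← expectation_const_mul]
    apply expectation_mono
    intro ω
    rw [← sub_mul, mul_comm]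
    by_cases h0 : f ω = 0
    · have : f' ω = 0 := le_antisymm (h0 ▸ hff ω) (hf0 ω)
      rw [h0, this]
      simp
    · apply mul_le_mul_of_nonneg_right _ (sub_nonneg.mpr (hff ω))
      refine le_trans ?_ (hc ω h0)
      exact_mod_cast Nat.sub_le _ _
  have hj1 : (0 : ℝ) < (j : ℝ) + 1 := by positivity
  have h4 : (expectation f - parityError M (j + 1) L) / 16 - 1 / ((j : ℝ) + 1) ≤
      expectation (fun ω => f ω * overflow A j ω (ω.1 ⟨j, hjn⟩)) := by
    rw [← mul_le_mul_iff_of_pos_left hj1]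
    refine le_trans (le_of_eq ?_) h2
    field_simp
  linarith

/-- Dropping a uniformly random cup preserves the expected average. -/
theorem expectation_sum_active {j : ℕ} (A : Emptier n) (hjn : j < n) {f : Fuzz n L → ℝ}
    (hswap : ∀ (x : Fin n) (hx : (x : ℕ) ≤ j) ω, f (swapLabels hjn x hx ω) = f ω) :
    ((j : ℝ) + 1) * expectation (fun ω =>
        f ω * (∑ i ∈ active ω.1 j, stateAfter A ω ((n - j) * L) i : ℕ)) =
      j * expectation (fun ω =>
        f ω * (∑ i ∈ active ω.1 (j + 1), stateAfter A ω ((n - j) * L) i : ℕ)) := by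
  have h1 := expectation_last_active hjn
    (fun ω i => f ω * (stateAfter A ω ((n - j) * L) i : ℝ)) (by
      intro x hx ω i
      rw [hswap, stateAfter_swapLabels A hjn x hx ω le_rfl])
  have h2 : (fun ω : Fuzz n L =>
      f ω * ((∑ i ∈ active ω.1 (j + 1), stateAfter A ω ((n - j) * L) i : ℕ) : ℝ)) =
      fun ω => f ω * (stateAfter A ω ((n - j) * L) (ω.1 ⟨j, hjn⟩) : ℝ) +
        f ω * ((∑ i ∈ active ω.1 j, stateAfter A ω ((n - j) * L) i : ℕ) : ℝ) := by
    funext ω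
    rw [sum_active_succ ω hjn]
    push_cast
    ring
  have h3 : (fun ω : Fuzz n L => ∑ i ∈ active ω.1 (j + 1),
      f ω * (stateAfter A ω ((n - j) * L) i : ℝ)) = fun ω =>
      f ω * ((∑ i ∈ active ω.1 (j + 1), stateAfter A ω ((n - j) * L) i : ℕ) : ℝ) := by
    funext ω
    push_cast
    rw [mul_sum]
  rw [h3, h2, expectation_add] at h1
  rw [h2, expectation_add]
  linarith

/-! ### Numerical estimates and harmonic growth -/

/-- The number of cups at which the growth of the average fill is measured. -/
noncomputable def finalCups (n : ℕ) : ℕ := ⌊(n : ℝ) ^ (2 / 3 : ℝ)⌋₊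

/-- Until the final phase, factors polynomial in `n` are polynomial in the number of cups, so
exponentially small parity errors absorb them. -/
theorem sq_le_finalCups_pow (n : ℕ) : (n : ℝ) ^ 2 ≤ ((finalCups n : ℝ) + 1) ^ 3 := by
  have h1 : (n : ℝ) ^ (2 / 3 : ℝ) ≤ (finalCups n : ℝ) + 1 := (Nat.lt_floor_add_one _).le
  have h2 : ((n : ℝ) ^ (2 / 3 : ℝ)) ^ 3 = (n : ℝ) ^ 2 := by
    rw [← Real.rpow_natCast, ← Real.rpow_mul (by positivity), ← Real.rpow_natCast]
    norm_num
  rw [← h2]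
  exact pow_le_pow_left₀ (by positivity) h1 3

theorem tendsto_finalCups : Filter.Tendsto finalCups Filter.atTop Filter.atTop := by
  apply tendsto_nat_floor_atTop.comp
  exact (tendsto_rpow_atTop (by norm_num)).comp tendsto_natCast_atTop_atTop

theorem log_finalCups_le {n : ℕ} (hn : 4096 ≤ n) :
    1 / 4 * Real.log n ≤ Real.log n - Real.log ((finalCups n : ℝ) + 1) := by
  have hn1 : (4096 : ℝ) ≤ n := by exact_mod_cast hn
  have hn0 : (0 : ℝ) < n := by linarith
  have h1 : (finalCups n : ℝ) ≤ (n : ℝ) ^ (2 / 3 : ℝ) := Nat.floor_le (by positivity)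
  have h2 : (1 : ℝ) ≤ (n : ℝ) ^ (2 / 3 : ℝ) := Real.one_le_rpow (by linarith) (by norm_num)
  have h3 : Real.log ((finalCups n : ℝ) + 1) ≤ Real.log (2 * (n : ℝ) ^ (2 / 3 : ℝ)) :=
    Real.log_le_log (by positivity) (by linarith)
  rw [Real.log_mul (by norm_num) (by positivity), Real.log_rpow hn0] at h3
  -- Here 4096 = 2^12 enters: 1 - 2/3 - 1/12 = 1/4.
  have h4 : 12 * Real.log 2 ≤ Real.log n := by
    have : (12 : ℝ) * Real.log 2 = Real.log ((2 : ℝ) ^ (12 : ℕ)) := by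
      rw [Real.log_pow]; norm_num
    rw [this]
    exact Real.log_le_log (by norm_num) (by norm_num; linarith)
  linarith

theorem finalCups_lt {n : ℕ} (hn : 2 ≤ n) : finalCups n < n := by
  rw [finalCups, Nat.floor_lt (by positivity)]
  have hn1 : (1 : ℝ) < n := by exact_mod_cast hn
  calc (n : ℝ) ^ (2 / 3 : ℝ) < (n : ℝ) ^ (1 : ℝ) :=
        Real.rpow_lt_rpow_of_exponent_lt hn1 (by norm_num)
    _ = n := Real.rpow_one _

theorem one_sub_pow_le {m : ℕ} (hm : 2 ≤ m) (hL : m ^ 2 ≤ L) :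
    (1 - 2 / (m : ℝ)) ^ (2 * L) ≤ (5 / 8) ^ m := by
  have hm0 : (2 : ℝ) ≤ m := by exact_mod_cast hm
  have h0 : 0 ≤ 1 - 2 / (m : ℝ) := by
    rw [sub_nonneg, div_le_one (by linarith)]
    exact hm0
  have h1 : 1 - 2 / (m : ℝ) ≤ Real.exp (-(2 / m)) := by
    have := Real.add_one_le_exp (-(2 / (m : ℝ)))
    linarith
  have hL' : (m : ℝ) ^ 2 ≤ L := by exact_mod_cast hL
  calc (1 - 2 / (m : ℝ)) ^ (2 * L) ≤ Real.exp (-(2 / m)) ^ (2 * L) := pow_le_pow_left₀ h0 h1 _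
    _ = Real.exp ((2 * L : ℕ) * (-(2 / m))) := (Real.exp_nat_mul _ _).symm
    _ ≤ Real.exp (m * (-1)) := by
        apply Real.exp_le_exp.mpr
        have : (m : ℝ) ≤ 2 * L * (2 / m) := by
          rw [mul_div_assoc', le_div_iff₀ (by linarith)]
          nlinarith
        push_cast
        linarith
    _ = Real.exp (-1) ^ m := Real.exp_nat_mul _ _
    _ ≤ (5 / 8) ^ m := pow_le_pow_left₀ (Real.exp_pos _).le
        (Real.exp_neg_one_lt_d9.le.trans (by norm_num)) _

theorem parityError_le {M m : ℕ} (hm : 2 ≤ m) (hL : m ^ 2 ≤ L) :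
    parityError M m L ≤ 3 * (M + 1) * (3 / 4) ^ m := by
  have h1 := one_sub_pow_le hm hL
  have h2 : (6 / 5 : ℝ) ^ m * (5 / 8) ^ m = (3 / 4) ^ m := by
    rw [← mul_pow]; norm_num
  have h3 : (6 / 5 : ℝ) ^ m * (2 * (5 / 8) ^ m + (1 - 2 / (m : ℝ)) ^ (2 * L)) ≤
      3 * (3 / 4) ^ m := by
    rw [← h2]
    have : (0 : ℝ) < (6 / 5) ^ m := by positivity
    nlinarith
  have := mul_le_mul_of_nonneg_left h3 (by positivity : (0 : ℝ) ≤ M + 1)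
  rw [parityError]
  linarith

/-- The phase length is fixed here: `n^(3n)` pays for the reciprocal drift `(2j²)^j`, a further
`n^n` for the polynomial factors. -/
theorem drift_error_le {n j : ℕ} (hn : 300 ≤ n) (hjn : j < n) (hj : 0 < j)
    (hL : n ^ (4 * n) ≤ L) :
    ((4 * n ^ 2 : ℕ) : ℝ) * ((2 * (j : ℝ) ^ 2 * (((4 * n ^ 2 : ℕ) : ℝ) + 2) ^ 2) *
      (2 * (j : ℝ) ^ 2) ^ j / L) ≤ 1 / 256 := by
  have hn1 : (300 : ℝ) ≤ n := by exact_mod_cast hn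
  have hj1 : (1 : ℝ) ≤ j := by exact_mod_cast hj
  have hjn1 : (j : ℝ) ≤ n := by exact_mod_cast hjn.le
  have hj2 : (j : ℝ) ^ 2 ≤ (n : ℝ) ^ 2 := by gcongr
  have hL' : (n : ℝ) ^ (4 * n) ≤ L := by exact_mod_cast hL
  have h1 : (2 * (j : ℝ) ^ 2) ^ j ≤ ((n : ℝ) ^ 3) ^ n := by
    calc (2 * (j : ℝ) ^ 2) ^ j ≤ (2 * (j : ℝ) ^ 2) ^ n :=
          pow_le_pow_right₀ (by nlinarith) hjn.le
      _ ≤ ((n : ℝ) ^ 3) ^ n := by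
          apply pow_le_pow_left₀ (by positivity)
          nlinarith [sq_nonneg (n : ℝ)]
  have h2 : (((4 * n ^ 2 : ℕ) : ℝ) + 2) ^ 2 ≤ (6 * (n : ℝ) ^ 2) ^ 2 := by
    apply pow_le_pow_left₀ (by positivity)
    push_cast
    nlinarith
  have hnn : (n : ℝ) ^ (4 * n) = ((n : ℝ) ^ 3) ^ n * (n : ℝ) ^ n := by
    rw [← pow_mul, ← pow_add]
    congr 1
    ring
  have hn10 : (n : ℝ) ^ 10 ≤ (n : ℝ) ^ n := pow_le_pow_right₀ (by linarith) (by omega)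
  have hpos : (0 : ℝ) < ((n : ℝ) ^ 3) ^ n := by positivity
  have hLpos : (0 : ℝ) < L := lt_of_lt_of_le (by positivity) hL'
  rw [mul_div_assoc', div_le_iff₀ hLpos]
  calc ((4 * n ^ 2 : ℕ) : ℝ) * ((2 * (j : ℝ) ^ 2 * (((4 * n ^ 2 : ℕ) : ℝ) + 2) ^ 2) *
      (2 * (j : ℝ) ^ 2) ^ j)
      ≤ (4 * (n : ℝ) ^ 2) * ((2 * (n : ℝ) ^ 2 * (6 * (n : ℝ) ^ 2) ^ 2) * ((n : ℝ) ^ 3) ^ n) := by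
        have : ((4 * n ^ 2 : ℕ) : ℝ) = 4 * (n : ℝ) ^ 2 := by push_cast; ring
        rw [this] at h2 ⊢
        gcongr
    _ = (288 * (n : ℝ) ^ 8) * ((n : ℝ) ^ 3) ^ n := by ring
    _ ≤ (1 / 256 * (n : ℝ) ^ 10) * ((n : ℝ) ^ 3) ^ n := by
        apply mul_le_mul_of_nonneg_right _ hpos.le
        have : (73728 : ℝ) ≤ (n : ℝ) ^ 2 := by nlinarith
        have h8 : (0 : ℝ) ≤ (n : ℝ) ^ 8 := by positivity
        nlinarith
    _ ≤ (1 / 256 * (n : ℝ) ^ n) * ((n : ℝ) ^ 3) ^ n := by gcongr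
    _ = 1 / 256 * (n : ℝ) ^ (4 * n) := by rw [hnn]; ring
    _ ≤ 1 / 256 * L := by gcongr

theorem sq_le_pow_four_mul (n : ℕ) (hn : 1 ≤ n) : n ^ 2 ≤ n ^ (4 * n) :=
  Nat.pow_le_pow_right hn (by omega)

/-- All error terms are eventually negligible, uniformly in the phase. -/
theorem exists_error_le : ∃ N : ℕ, ∀ n, N ≤ n → ∀ L, n ^ (4 * n) ≤ L → ∀ j, finalCups n < j →
    j < n → parityError (4 * n ^ 2) (j + 1) L / 16 + 1 / ((j : ℝ) + 1) +
      ((4 * n ^ 2 : ℕ) : ℝ) * ((2 * (j : ℝ) ^ 2 * (((4 * n ^ 2 : ℕ) : ℝ) + 2) ^ 2) *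
        (2 * (j : ℝ) ^ 2) ^ j / L) ≤ 1 / 64 := by
  have hlim := tendsto_pow_const_mul_const_pow_of_abs_lt_one 3
    (by norm_num [abs_of_pos] : |(3 / 4 : ℝ)| < 1)
  obtain ⟨m₀, hm₀⟩ := Filter.eventually_atTop.mp
    -- 240 = 15 · 16, with 15 from `h4` and 1/16 the target in `e3`; each of the three errors is
    -- then at most 1/256.
    (hlim.eventually (ge_mem_nhds (by norm_num : (0 : ℝ) < 1 / 240)))
  obtain ⟨N, hN⟩ := Filter.eventually_atTop.mp
    (tendsto_finalCups.eventually_ge_atTop (max m₀ 256))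
  refine ⟨max N 300, fun n hn L hL j hkj hjn => ?_⟩
  have hk := hN n ((le_max_left _ _).trans hn)
  have hn300 := (le_max_right _ _).trans hn
  have hj256 : 256 ≤ j := ((le_max_right _ _).trans hk).trans hkj.le
  have hjm₀ : m₀ ≤ j + 1 := ((le_max_left _ _).trans hk).trans (by omega)
  have e1 := drift_error_le hn300 hjn (by omega) hL
  have e2 : 1 / ((j : ℝ) + 1) ≤ 1 / 256 := by
    have : (256 : ℝ) ≤ j := by exact_mod_cast hj256
    apply one_div_le_one_div_of_le <;> linarith
  have e3 : parityError (4 * n ^ 2) (j + 1) L ≤ 1 / 16 := by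
    have hLm : (j + 1) ^ 2 ≤ L :=
      (Nat.pow_le_pow_left hjn 2).trans ((sq_le_pow_four_mul n (by omega)).trans hL)
    refine (parityError_le (by omega) hLm).trans ?_
    have h1 : (n : ℝ) ^ 2 ≤ (((j + 1 : ℕ)) : ℝ) ^ 3 := by
      refine (sq_le_finalCups_pow n).trans ?_
      have : (finalCups n : ℝ) + 1 ≤ ((j + 1 : ℕ) : ℝ) := by exact_mod_cast (by omega)
      gcongr
    have h2 := hm₀ (j + 1) hjm₀
    have h3 : (1 : ℝ) ≤ (n : ℝ) ^ 2 := by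
      have : (1 : ℝ) ≤ n := by exact_mod_cast (by omega : 1 ≤ n)
      nlinarith
    have h4 : 3 * (((4 * n ^ 2 : ℕ) : ℝ) + 1) ≤ 15 * (((j + 1 : ℕ)) : ℝ) ^ 3 := by
      push_cast at h1 ⊢
      linarith
    calc 3 * (((4 * n ^ 2 : ℕ) : ℝ) + 1) * (3 / 4) ^ (j + 1)
        ≤ 15 * (((j + 1 : ℕ)) : ℝ) ^ 3 * (3 / 4) ^ (j + 1) := by gcongr
      _ ≤ 1 / 16 := by linarith
  linarith

/-- A quantity which grows harmonically grows logarithmically. -/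
theorem log_growth {Y : ℕ → ℝ} {k n : ℕ} {c e : ℝ} (hkn : k < n) (hc : 0 ≤ c) (he : 0 ≤ e)
    (h0 : 0 ≤ Y (n - 1))
    (hstep : ∀ j, k < j → j < n → Y j + c / j - e ≤ Y (j - 1)) :
    c * (Real.log n - Real.log ((k : ℝ) + 1)) - n * e ≤ Y k := by
  have key : ∀ d j : ℕ, k ≤ j → j + d + 1 = n →
      c * (Real.log n - Real.log ((j : ℝ) + 1)) - d * e ≤ Y j := by
    intro d
    induction d with
    | zero =>
      intro j _ hj
      have h2 : (j : ℝ) + 1 = n := by exact_mod_cast hj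
      obtain rfl : j = n - 1 := by omega
      rw [h2]
      simpa using h0
    | succ d ih =>
      intro j hkj hj
      have h1 := ih (j + 1) (by omega) (by omega)
      have h2 := hstep (j + 1) (by omega) (by omega)
      rw [Nat.add_sub_cancel] at h2
      push_cast at h1 h2 ⊢
      have hpos : (0 : ℝ) < (j : ℝ) + 1 := by positivity
      have h3 : Real.log ((j : ℝ) + 1 + 1) - Real.log ((j : ℝ) + 1) ≤ 1 / ((j : ℝ) + 1) := by
        rw [← Real.log_div (by positivity) hpos.ne']
        have := Real.log_le_sub_one_of_pos
          (show 0 < ((j : ℝ) + 1 + 1) / ((j : ℝ) + 1) by positivity)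
        refine this.trans (le_of_eq ?_)
        field_simp
        ring
      have h4 := mul_le_mul_of_nonneg_left h3 hc
      have h5 : c * (1 / ((j : ℝ) + 1)) = c / ((j : ℝ) + 1) := by ring
      linarith
  have h1 := key (n - 1 - k) k le_rfl (by omega)
  have h2 : ((n - 1 - k : ℕ) : ℝ) ≤ n := by exact_mod_cast (by omega)
  have h3 := mul_le_mul_of_nonneg_right h2 he
  linarith

/-! ### Growth of the expected average fill -/

theorem cast_le_two_mul_backlog (S : State n) (i : Fin n) : (S i : ℝ) ≤ 2 * backlog S := by
  have h : (S i : ℝ) ≤ ((univ.sup S : ℕ) : ℝ) := by exact_mod_cast le_sup (mem_univ i)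
  rw [backlog]
  linarith

theorem averageFill_eq (ω : Fuzz n L) (k : ℕ) (S : State n) :
    averageFill ω k S = ((∑ i ∈ active ω.1 k, S i : ℕ) : ℝ) / (2 * k) := by
  rw [averageFill, sum_active]
  push_cast
  simp only [fill]
  rw [← sum_div, div_div]

theorem sum_active_le {ω : Fuzz n L} {k : ℕ} (hk : k ≤ n) {S : State n} {g : ℝ}
    (h : backlog S ≤ g) : ((∑ i ∈ active ω.1 k, S i : ℕ) : ℝ) ≤ k * (2 * g) := by
  push_cast
  refine (sum_le_card_nsmul _ _ (2 * g) fun i _ =>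
    (cast_le_two_mul_backlog S i).trans (by linarith)).trans ?_
  rw [card_active _ hk, nsmul_eq_mul]

theorem averageFill_le_backlog (ω : Fuzz n L) {k : ℕ} (hk0 : 0 < k) (hk : k ≤ n) (S : State n) :
    averageFill ω k S ≤ backlog S := by
  have hk' : (0 : ℝ) < k := by exact_mod_cast hk0
  rw [averageFill_eq, div_le_iff₀ (by positivity)]
  have := sum_active_le (ω := ω) hk (le_refl (backlog S))
  linarith

/-- The (weighted) expected average of the active cups at the end of the phase with `j + 1`
cups, in half-units. -/
noncomputable def phaseAverage (A : Emptier n) (L : ℕ) (f : Fuzz n L → ℝ) (j : ℕ) : ℝ :=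
  expectation (fun ω : Fuzz n L =>
    f ω * (∑ i ∈ active ω.1 (j + 1), stateAfter A ω ((n - j) * L) i : ℕ)) / ((j : ℝ) + 1)

theorem phaseAverage_pred (A : Emptier n) {j : ℕ} (hj : 0 < j) (hjn : j < n)
    (f : Fuzz n L → ℝ) :
    phaseAverage A L f (j - 1) = (expectation (fun ω : Fuzz n L =>
      f ω * (∑ i ∈ active ω.1 j, stateAfter A ω ((n - j) * L) i : ℕ)) +
        expectation (fun ω => f ω * gain A j ω)) / j := by
  obtain ⟨i, rfl⟩ : ∃ i, j = i + 1 := ⟨j - 1, by omega⟩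
  rw [Nat.add_sub_cancel, phaseAverage, ← expectation_add, ← phase_end_eq (by omega)]
  push_cast
  congr 2
  funext ω
  rw [gain]
  push_cast
  ring

theorem phaseAverage_eq (A : Emptier n) {j : ℕ} (hj : 0 < j) (hjn : j < n) {f : Fuzz n L → ℝ}
    (hswap : ∀ (x : Fin n) (hx : (x : ℕ) ≤ j) ω, f (swapLabels hjn x hx ω) = f ω) :
    phaseAverage A L f j = expectation (fun ω : Fuzz n L =>
      f ω * (∑ i ∈ active ω.1 j, stateAfter A ω ((n - j) * L) i : ℕ)) / j := by
  have h := expectation_sum_active A hjn hswap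
  have hj' : (0 : ℝ) < j := by exact_mod_cast hj
  rw [phaseAverage, div_eq_div_iff (by positivity) hj'.ne']
  linarith

theorem phaseAverage_nonneg (A : Emptier n) {f : Fuzz n L → ℝ} (hf : ∀ ω, 0 ≤ f ω) (j : ℕ) :
    0 ≤ phaseAverage A L f j :=
  div_nonneg (expectation_nonneg fun ω => mul_nonneg (hf ω) (by positivity)) (by positivity)

theorem expectation_averageFill (A : Emptier n) {k : ℕ} (hk : 0 < k) (hkn : k < n) :
    expectation (fun ω : Fuzz n L => averageFill ω k (stateAtPhase A ω k)) =
      phaseAverage A L (fun _ => 1) k / 2 := by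
  rw [phaseAverage_eq A hk hkn (fun _ _ _ => rfl)]
  simp only [averageFill_eq, stateAtPhase, one_mul]
  rw [expectation_div_const]
  field_simp

/-- The errors which are negligible in every phase. -/
def ErrorsNegligible (n L j : ℕ) : Prop :=
  parityError (4 * n ^ 2) (j + 1) L / 16 + 1 / ((j : ℝ) + 1) +
      ((4 * n ^ 2 : ℕ) : ℝ) * ((2 * (j : ℝ) ^ 2 * (((4 * n ^ 2 : ℕ) : ℝ) + 2) ^ 2) *
        (2 * (j : ℝ) ^ 2) ^ j / L) ≤ 1 / 64

/-- By Markov's inequality a moderate expected average keeps the total water below `4n²` with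
probability at least 1/2. Restricted to this event, the gain is at least 1/32 minus the errors. -/
theorem phaseAverage_step {A : Emptier n} (hA : A.IsScoreBased ∨ A.IsMonotone) (hL : 0 < L)
    {j : ℕ} (hj : 0 < j) (hjn : j < n) (herr : ErrorsNegligible n L j)
    (hsmall : phaseAverage A L (fun _ => 1) j ≤ n) :
    phaseAverage A L (fun _ => 1) j + 1 / 64 / j ≤ phaseAverage A L (fun _ => 1) (j - 1) := by
  classical
  set W : Fuzz n L → ℕ := fun ω => ∑ i ∈ active ω.1 (j + 1), stateAfter A ω ((n - j) * L) i
    with hW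
  have hWswap : ∀ (x : Fin n) (hx : (x : ℕ) ≤ j) ω, W (swapLabels hjn x hx ω) = W ω := by
    intro x hx ω
    simp only [hW]
    rw [stateAfter_swapLabels A hjn x hx ω le_rfl, active_swapLabels]
  set f : Fuzz n L → ℝ := fun ω => if W ω ≤ 4 * n ^ 2 then 1 else 0 with hf
  have hf0 : ∀ ω, 0 ≤ f ω := fun ω => by simp only [hf]; split_ifs <;> norm_num
  have hf1 : ∀ ω, f ω ≤ 1 := fun ω => by simp only [hf]; split_ifs <;> norm_num
  have hfW : ∀ ω, f ω ≠ 0 → W ω ≤ 4 * n ^ 2 := fun ω h => by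
    by_contra hcon
    exact h (if_neg hcon)
  have hn : (1 : ℝ) ≤ n := by exact_mod_cast (by omega : 1 ≤ n)
  have hprob : 1 / 2 ≤ expectation f := by
    have h1 : expectation (fun ω => (W ω : ℝ)) ≤ n * n := by
      have h2 : phaseAverage A L (fun _ => 1) j =
        expectation (fun ω => (W ω : ℝ)) / ((j : ℝ) + 1) := by
        simp only [phaseAverage, one_mul, hW]
      rw [h2, div_le_iff₀ (by positivity)] at hsmall
      have h3 : (j : ℝ) + 1 ≤ n := by exact_mod_cast hjn
      exact hsmall.trans (mul_le_mul_of_nonneg_left h3 (by positivity))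
    have h2 : ∀ ω, 1 - (1 / (4 * (n : ℝ) ^ 2)) * (W ω : ℝ) ≤ f ω := by
      intro ω
      simp only [hf]
      split_ifs with h
      · have : 0 ≤ 1 / (4 * (n : ℝ) ^ 2) * (W ω : ℝ) := by positivity
        linarith
      · have h3 : (4 * (n : ℝ) ^ 2) ≤ W ω := by exact_mod_cast (not_le.mp h).le
        have h4 : 1 ≤ 1 / (4 * (n : ℝ) ^ 2) * (W ω : ℝ) := by
          rw [one_div_mul_eq_div, one_le_div (by positivity)]
          exact h3
        linarith
    have h3 := expectation_mono h2
    rw [expectation_sub, expectation_const, expectation_const_mul] at h3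
    have h4 : 1 / (4 * (n : ℝ) ^ 2) * expectation (fun ω => (W ω : ℝ)) ≤
        1 / (4 * (n : ℝ) ^ 2) * (n * n) := mul_le_mul_of_nonneg_left h1 (by positivity)
    have h5 : 1 / (4 * (n : ℝ) ^ 2) * (n * n) = 1 / 4 := by field_simp
    linarith
  have hgain := le_expectation_gain (L := L) (M := 4 * n ^ 2) (c := ((4 * n ^ 2 : ℕ) : ℝ))
    (f := f) (f' := f) hA hj hjn hL hf0 (fun _ => le_rfl) hf1 (by
      intro ω s z hs
      simp only [hf, hW]
      rw [stateAfter_update A ω s z hs]) (by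
      intro x hx ω
      simp only [hf, hWswap]) hfW (by
      intro ω h
      have h1 := hfW ω h
      simp only [hW] at h1
      rw [sum_active_succ ω hjn] at h1
      exact_mod_cast (Nat.le_add_right _ _).trans h1)
  have hle : expectation (fun ω => f ω * gain A j ω) ≤
      expectation (fun ω : Fuzz n L => 1 * gain A j ω) := by
    apply expectation_mono
    intro ω
    exact mul_le_mul_of_nonneg_right (hf1 ω) (gain_nonneg A hj hjn.le ω)
  have hj' : (0 : ℝ) < j := by exact_mod_cast hj
  rw [phaseAverage_pred A hj hjn, phaseAverage_eq A hj hjn (fun _ _ _ => rfl), add_div]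
  gcongr
  unfold ErrorsNegligible at herr
  linarith

theorem phaseAverage_le_pred (A : Emptier n) {j : ℕ} (hj : 0 < j) (hjn : j < n) :
    phaseAverage A L (fun _ => 1) j ≤ phaseAverage A L (fun _ => 1) (j - 1) := by
  rw [phaseAverage_pred A hj hjn, phaseAverage_eq A hj hjn (fun _ _ _ => rfl)]
  gcongr
  have := expectation_nonneg (X := fun ω : Fuzz n L => 1 * gain A j ω)
    (fun ω => mul_nonneg zero_le_one (gain_nonneg A hj hjn.le ω))
  linarith

theorem phaseAverage_antitone (A : Emptier n) {k j : ℕ} (hkj : k ≤ j) (hjn : j < n) :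
    phaseAverage A L (fun _ => 1) j ≤ phaseAverage A L (fun _ => 1) k := by
  induction j, hkj using Nat.le_induction with
  | base => exact le_rfl
  | succ j _ ih =>
    exact (phaseAverage_le_pred A (Nat.succ_pos j) hjn).trans (ih (by omega))

theorem log_le_expectation_averageFill {A : Emptier n}
    (hA : A.IsScoreBased ∨ A.IsMonotone) (hn : 4096 ≤ n) (hL : 0 < L)
    (hk : 0 < finalCups n) (herr : ∀ j, finalCups n < j → j < n → ErrorsNegligible n L j) :
    1 / 512 * Real.log n ≤ expectation (fun ω : Fuzz n L =>
      averageFill ω (finalCups n) (stateAtPhase A ω (finalCups n))) := by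
  have hkn : finalCups n < n := finalCups_lt (by omega)
  rw [expectation_averageFill A hk hkn]
  have hn1 : (4096 : ℝ) ≤ n := by exact_mod_cast hn
  -- An average of `n` is already more than enough. Otherwise, as averages only grow from phase to
  -- phase, all earlier ones are below `n` too.
  by_cases hlarge : (n : ℝ) ≤ phaseAverage A L (fun _ => 1) (finalCups n)
  · have := Real.log_le_sub_one_of_pos (by linarith : (0 : ℝ) < n)
    linarith
  · have h1 := log_growth (Y := phaseAverage A L (fun _ => 1)) hkn
      (by norm_num : (0 : ℝ) ≤ 1 / 64) le_rfl
      (phaseAverage_nonneg A (fun _ => zero_le_one) _) (by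
        intro j hkj hjn
        rw [sub_zero]
        exact phaseAverage_step hA hL (by omega) hjn (herr j hkj hjn)
          ((phaseAverage_antitone A hkj.le hjn).trans (not_le.mp hlarge).le))
    have h2 := log_finalCups_le hn
    linarith

/-! ### Guarantees with high probability -/

open Classical in
/-- The indicator of a backlog of at most `g` at the beginning of all phases with at least `j`
cups. -/
noncomputable def bounded (A : Emptier n) (g : ℝ) (j : ℕ) (ω : Fuzz n L) : ℝ :=
  if ∀ i, j ≤ i → backlog (stateAfter A ω ((n - i) * L)) ≤ g then 1 else 0

theorem bounded_nonneg (A : Emptier n) (g : ℝ) (j : ℕ) (ω : Fuzz n L) : 0 ≤ bounded A g j ω := by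
  unfold bounded
  split_ifs <;> norm_num

theorem bounded_le_one (A : Emptier n) (g : ℝ) (j : ℕ) (ω : Fuzz n L) : bounded A g j ω ≤ 1 := by
  unfold bounded
  split_ifs <;> norm_num

theorem backlog_le_of_bounded {A : Emptier n} {g : ℝ} {j : ℕ} {ω : Fuzz n L}
    (h : bounded A g j ω ≠ 0) : backlog (stateAfter A ω ((n - j) * L)) ≤ g := by
  by_contra hcon
  exact h (if_neg fun hall => hcon (hall j le_rfl))

theorem bounded_pred_le (A : Emptier n) (g : ℝ) (j : ℕ) (ω : Fuzz n L) :
    bounded A g (j - 1) ω ≤ bounded A g j ω := by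
  by_cases h : ∀ i, j - 1 ≤ i → backlog (stateAfter A ω ((n - i) * L)) ≤ g
  · rw [bounded, bounded, if_pos h, if_pos fun i hi => h i (by omega)]
  · rw [bounded, if_neg h]
    exact bounded_nonneg A g j ω

theorem expectation_bounded_sub_le {A : Emptier n} {g q : ℝ} (hq : A.BacklogGuarantee L g q)
    {j : ℕ} :
    expectation (bounded (L := L) A g j) - expectation (bounded (L := L) A g (j - 1)) ≤ q := by
  classical
  have h1 := hq ((n - (j - 1)) * L) (Nat.mul_le_mul_right L (Nat.sub_le _ _))
  have h2 : expectation (bounded (L := L) A g j) - expectation (bounded (L := L) A g (j - 1)) ≤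
      1 - probability (fun ω : Fuzz n L =>
        backlog (stateAfter A ω ((n - (j - 1)) * L)) ≤ g) := by
    rw [← expectation_sub, ← expectation_const (n := n) (L := L) 1, probability,
      ← expectation_sub]
    apply expectation_mono
    intro ω
    by_cases hb : backlog (stateAfter A ω ((n - (j - 1)) * L)) ≤ g
    · rw [if_pos hb]
      have : bounded A g j ω ≤ bounded A g (j - 1) ω := by
        by_cases h : ∀ i, j ≤ i → backlog (stateAfter A ω ((n - i) * L)) ≤ g
        · rw [bounded, bounded, if_pos h, if_pos]
          intro i hi
          rcases hi.eq_or_lt with rfl | hlt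
          · exact hb
          · exact h i (by omega)
        · rw [bounded, if_neg h]
          exact bounded_nonneg A g (j - 1) ω
      linarith
    · rw [if_neg hb]
      have := bounded_le_one A g j ω
      have := bounded_nonneg A g (j - 1) ω
      linarith
  linarith

theorem le_expectation_bounded {A : Emptier n} {g q : ℝ} (hg : 0 ≤ g) (hq0 : 0 ≤ q)
    (hq : A.BacklogGuarantee L g q) (j : ℕ) :
    1 - n * q ≤ expectation (bounded (L := L) A g j) := by
  -- For `i ≥ n` the truncated `n - i` is 0, so only the empty initial state is tested.
  have hn : ∀ j, n ≤ j → expectation (bounded (L := L) A g j) = 1 := by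
    intro j hj
    rw [← expectation_const (n := n) (L := L) 1]
    congr 1
    funext ω
    rw [bounded, if_pos]
    intro i hi
    rw [Nat.sub_eq_zero_of_le (hj.trans hi), zero_mul]
    have h0 : (univ.sup (stateAfter A ω 0) : ℕ) = 0 :=
      Nat.le_zero.mp (Finset.sup_le fun i _ => le_rfl)
    rw [backlog, h0]
    simpa using hg
  have key : ∀ d, d ≤ n → 1 - d * q ≤ expectation (bounded (L := L) A g (n - d)) := by
    intro d
    induction d with
    | zero => intro _; rw [Nat.sub_zero, hn _ le_rfl]; simp
    | succ d ih =>
      intro hd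
      have h1 := ih (by omega)
      have h2 := expectation_bounded_sub_le hq (j := n - d)
      have h3 : n - d - 1 = n - (d + 1) := by omega
      rw [h3] at h2
      push_cast
      linarith
  rcases le_total n j with h | h
  · rw [hn j h]
    have : 0 ≤ n * q := by positivity
    linarith
  · have h1 := key (n - j) (Nat.sub_le _ _)
    rw [Nat.sub_sub_self h] at h1
    have h2 : ((n - j : ℕ) : ℝ) ≤ n := by exact_mod_cast Nat.sub_le _ _
    have h3 := mul_le_mul_of_nonneg_right h2 hq0
    linarith

/-- Passing to the smaller event loses probability at most `q`, where fills are at most `2g`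
half-units. This is charged twice, to the old average and to the overflow: together at most `4gq`.
-/
theorem bounded_phaseAverage_step {A : Emptier n} (hA : A.IsScoreBased ∨ A.IsMonotone)
    (hL : 0 < L) {j : ℕ} (hj : 0 < j) (hjn : j < n) (herr : ErrorsNegligible n L j) {g q : ℝ}
    (hg : 0 ≤ g) (hgn : g ≤ n) (hq0 : 0 ≤ q) (hq : A.BacklogGuarantee L g q)
    (hnq : n * q ≤ 1 / 2) :
    phaseAverage A L (bounded A g j) j + 1 / 64 / j - 4 * g * q ≤
      phaseAverage A L (bounded A g (j - 1)) (j - 1) := by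
  have hswap : ∀ (x : Fin n) (hx : (x : ℕ) ≤ j) (ω : Fuzz n L),
      bounded A g j (swapLabels hjn x hx ω) = bounded A g j ω := by
    intro x hx ω
    have : ∀ i, j ≤ i → stateAfter A (swapLabels hjn x hx ω) ((n - i) * L) =
        stateAfter A ω ((n - i) * L) := fun i hi =>
      stateAfter_swapLabels A hjn x hx ω (Nat.mul_le_mul_right L (by omega))
    unfold bounded
    congr 1
    apply propext
    exact forall₂_congr fun i hi => by rw [this i hi]
  have hupd : ∀ (ω : Fuzz n L) (s : Fin (n * L)) z, (n - j) * L ≤ s →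
      bounded A g j (ω.1, Function.update ω.2 s z) = bounded A g j ω := by
    intro ω s z hs
    have : ∀ i, j ≤ i → stateAfter A (ω.1, Function.update ω.2 s z) ((n - i) * L) =
        stateAfter A ω ((n - i) * L) := fun i hi =>
      stateAfter_update A ω s z ((Nat.mul_le_mul_right L (by omega)).trans hs)
    unfold bounded
    congr 1
    apply propext
    exact forall₂_congr fun i hi => by rw [this i hi]
  have hj' : (1 : ℝ) ≤ j := by exact_mod_cast hj
  have hjn' : (j : ℝ) + 1 ≤ n := by exact_mod_cast hjn
  have hΔ := expectation_bounded_sub_le hq (j := j)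
  have hprob := le_expectation_bounded hg hq0 hq j
  have hgain := le_expectation_gain (L := L) (M := 4 * n ^ 2) (c := 2 * g)
    (f := bounded A g j) (f' := bounded A g (j - 1)) hA hj hjn hL
    (bounded_nonneg A g (j - 1)) (bounded_pred_le A g j) (bounded_le_one A g j) hupd hswap (by
      intro ω h
      have h1 := sum_active_le (ω := ω) (k := j + 1) hjn (backlog_le_of_bounded h)
      have h2 : ((∑ i ∈ active ω.1 (j + 1), stateAfter A ω ((n - j) * L) i : ℕ) : ℝ) ≤
          (4 * n ^ 2 : ℕ) := by
        push_cast at h1 ⊢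
        nlinarith
      exact_mod_cast h2) (by
      intro ω h
      have := cast_le_two_mul_backlog (stateAfter A ω ((n - j) * L)) (ω.1 ⟨j, hjn⟩)
      linarith [backlog_le_of_bounded h])
  have hloss : expectation (fun ω : Fuzz n L => bounded A g j ω *
        (∑ i ∈ active ω.1 j, stateAfter A ω ((n - j) * L) i : ℕ)) -
      expectation (fun ω : Fuzz n L => bounded A g (j - 1) ω *
        (∑ i ∈ active ω.1 j, stateAfter A ω ((n - j) * L) i : ℕ)) ≤
      j * (2 * g) * (expectation (bounded (L := L) A g j) -
        expectation (bounded (L := L) A g (j - 1))) := by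
    rw [← expectation_sub, ← expectation_sub, ← expectation_const_mul]
    apply expectation_mono
    intro ω
    rw [← sub_mul, mul_comm]
    by_cases h0 : bounded A g j ω = 0
    · have : bounded A g (j - 1) ω = 0 :=
        le_antisymm (h0 ▸ bounded_pred_le A g j ω) (bounded_nonneg A g (j - 1) ω)
      rw [h0, this]
      simp
    · exact mul_le_mul_of_nonneg_right (sum_active_le hjn.le (backlog_le_of_bounded h0))
        (sub_nonneg.mpr (bounded_pred_le A g j ω))
  rw [phaseAverage_pred A hj hjn, phaseAverage_eq A hj hjn hswap, ← sub_nonneg]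
  set Δ := expectation (bounded (L := L) A g j) - expectation (bounded (L := L) A g (j - 1))
  have h1 : 2 * g * Δ ≤ 2 * g * q := mul_le_mul_of_nonneg_left hΔ (by positivity)
  have h2 : j * (2 * g) * Δ ≤ j * (2 * g) * q := mul_le_mul_of_nonneg_left hΔ (by positivity)
  have h3 : 2 * g * q ≤ j * (2 * g * q) := le_mul_of_one_le_left (by positivity) hj'
  unfold ErrorsNegligible at herr
  have hjpos : (0 : ℝ) < j := by linarith
  rw [← mul_nonneg_iff_of_pos_left hjpos]
  field_simp
  nlinarith

theorem not_backlogGuarantee {A : Emptier n} (hA : A.IsScoreBased ∨ A.IsMonotone)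
    (hn : 4096 ≤ n) (hL : 0 < L) (herr : ∀ j, finalCups n < j → j < n → ErrorsNegligible n L j)
    {g q : ℝ} (hg : g ≤ 1 / 2000 * Real.log n) (hq0 : 0 ≤ q) (hnq : n * q ≤ 1 / 2) :
    ¬ A.BacklogGuarantee L g q := by
  intro hguar
  have hn1 : (4096 : ℝ) ≤ n := by exact_mod_cast hn
  have hlog : 0 < Real.log n := Real.log_pos (by linarith)
  have hlogn := Real.log_le_sub_one_of_pos (by linarith : (0 : ℝ) < n)
  set g' := max g 0 with hg'
  have hg0 : 0 ≤ g' := le_max_right _ _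
  have hgl : g' ≤ 1 / 2000 * Real.log n := max_le hg (by positivity)
  have hguar' : A.BacklogGuarantee L g' q := by
    intro t ht
    refine (hguar t ht).trans ?_
    apply expectation_mono
    intro ω
    by_cases h : backlog (stateAfter A ω t) ≤ g
    · rw [if_pos h, if_pos (h.trans (le_max_left _ _))]
    · rw [if_neg h]
      split_ifs <;> norm_num
  have hkn : finalCups n < n := finalCups_lt (by omega)
  have h1 := log_growth (Y := fun j => phaseAverage A L (bounded A g' j) j) hkn
    (by norm_num : (0 : ℝ) ≤ 1 / 64) (by positivity : 0 ≤ 4 * g' * q)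
    (phaseAverage_nonneg A (bounded_nonneg A g' _) _)
    (fun j hkj hjn => bounded_phaseAverage_step hA hL (by omega) hjn (herr j hkj hjn) hg0
      (by linarith) hq0 hguar' hnq)
  have h2 : phaseAverage A L (bounded A g' (finalCups n)) (finalCups n) ≤ 2 * g' := by
    rw [phaseAverage, div_le_iff₀ (by positivity),
      ← expectation_const (n := n) (L := L) (2 * g' * _)]
    apply expectation_mono
    intro ω
    by_cases h0 : bounded A g' (finalCups n) ω = 0
    · rw [h0, zero_mul]
      positivity
    · refine (mul_le_of_le_one_left (by positivity) (bounded_le_one A g' _ ω)).trans ?_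
      refine (sum_active_le hkn (backlog_le_of_bounded h0)).trans (le_of_eq ?_)
      push_cast
      ring
  -- The bounds combine to `log n / 256 - 4g' ≤ 2g'`, impossible because 1/2000 < 1/1536.
  have h3 := log_finalCups_le hn
  have h4 : n * (4 * g' * q) ≤ 4 * g' := by
    have := mul_le_mul_of_nonneg_left hnq (by positivity : 0 ≤ 4 * g')
    linarith
  linarith

end CupGame

/-! ### Assembling the two statements -/

theorem theorem6p3 :
    ∃ c : ℕ,
      -- the expected average fill at the beginning of the `n ^ (2/3)`-cup phase is `Ω(log n)`
      (∃ κ : ℝ, 0 < κ ∧ ∃ N : ℕ, ∀ n : ℕ, N ≤ n → ∀ L : ℕ, n ^ (c * n) ≤ L →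
        ∀ A : CupGame.Emptier n, A.IsScoreBased ∨ A.IsMonotone →
          κ * Real.log n ≤ CupGame.expectation (fun ω : CupGame.Fuzz n L =>
            CupGame.averageFill ω ⌊(n : ℝ) ^ (2 / 3 : ℝ)⌋₊
              (CupGame.stateAtPhase A ω ⌊(n : ℝ) ^ (2 / 3 : ℝ)⌋₊))) ∧
      -- there is no unending backlog guarantee of `o(log n)`, in expectation or with high
      -- probability
      (∀ g : ℕ → ℝ, g =o[Filter.atTop] (fun n : ℕ => Real.log n) → ∀ a : ℝ, 1 < a →
        ∃ N : ℕ, ∀ n : ℕ, N ≤ n → ∀ L : ℕ, n ^ (c * n) ≤ L →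
          ∀ A : CupGame.Emptier n, A.IsScoreBased ∨ A.IsMonotone →
            ¬ A.ExpectedBacklogGuarantee L (g n) ∧
            ¬ A.BacklogGuarantee L (g n) ((n : ℝ) ^ (-a))) := by
  obtain ⟨N₁, hN₁⟩ := CupGame.exists_error_le
  obtain ⟨N₂, hN₂⟩ := Filter.eventually_atTop.mp
    (CupGame.tendsto_finalCups.eventually_ge_atTop 1)
  have hLpos : ∀ {n L : ℕ}, 4096 ≤ n → n ^ (4 * n) ≤ L → 0 < L := fun hn hL =>
    (Nat.pow_pos (by omega)).trans_le hL
  have hfill : ∀ n : ℕ, max (max N₁ N₂) 4096 ≤ n → ∀ L : ℕ, n ^ (4 * n) ≤ L →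
      ∀ A : CupGame.Emptier n, A.IsScoreBased ∨ A.IsMonotone →
        1 / 512 * Real.log n ≤ CupGame.expectation (fun ω : CupGame.Fuzz n L =>
          CupGame.averageFill ω (CupGame.finalCups n)
            (CupGame.stateAtPhase A ω (CupGame.finalCups n))) := by
    intro n hn L hL A hA
    have h1 : N₁ ≤ n := by omega
    have h2 : N₂ ≤ n := by omega
    have h3 : 4096 ≤ n := by omega
    exact CupGame.log_le_expectation_averageFill hA h3 (hLpos h3 hL) (hN₂ n h2)
      (fun j hkj hjn => hN₁ n h1 L hL j hkj hjn)
  refine ⟨4, ⟨1 / 512, by norm_num, max (max N₁ N₂) 4096, hfill⟩, ?_⟩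
  intro g hg a ha
  obtain ⟨N₃, hN₃⟩ := Filter.eventually_atTop.mp
    (hg.bound (by norm_num : (0 : ℝ) < 1 / 2000))
  have hlim : Filter.Tendsto (fun n : ℕ => (n : ℝ) ^ (-(a - 1))) Filter.atTop (nhds 0) :=
    (tendsto_rpow_neg_atTop (by linarith)).comp tendsto_natCast_atTop_atTop
  obtain ⟨N₄, hN₄⟩ := Filter.eventually_atTop.mp
    (hlim.eventually (ge_mem_nhds (by norm_num : (0 : ℝ) < 1 / 2)))
  refine ⟨max (max (max N₁ N₂) 4096) (max N₃ N₄), fun n hn L hL A hA => ?_⟩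
  have h0 : max (max N₁ N₂) 4096 ≤ n := (le_max_left _ _).trans hn
  have h1 : N₁ ≤ n := by omega
  have h2 : N₂ ≤ n := by omega
  have h3 : N₃ ≤ n := by omega
  have h4 : N₄ ≤ n := by omega
  have h5 : 4096 ≤ n := by omega
  have hn1 : (4096 : ℝ) ≤ n := by exact_mod_cast h5
  have hlog : 0 < Real.log n := Real.log_pos (by linarith)
  have hgn : g n ≤ 1 / 2000 * Real.log n := by
    have := hN₃ n h3
    rw [Real.norm_eq_abs, Real.norm_eq_abs, abs_of_pos hlog] at this
    exact (le_abs_self _).trans this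
  constructor
  · intro hguar
    have h6 := hfill n h0 L hL A hA
    have h7 := hguar ((n - CupGame.finalCups n) * L)
      (Nat.mul_le_mul_right L (Nat.sub_le _ _))
    have h8 := CupGame.expectation_mono (fun ω : CupGame.Fuzz n L =>
      CupGame.averageFill_le_backlog ω (hN₂ n h2) (CupGame.finalCups_lt (by omega)).le
        (CupGame.stateAtPhase A ω (CupGame.finalCups n)))
    have h9 := (h6.trans h8).trans h7
    linarith
  · refine CupGame.not_backlogGuarantee hA h5 (hLpos h5 hL)
      (fun j hkj hjn => hN₁ n h1 L hL j hkj hjn) hgn (by positivity) ?_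
    -- The failure probabilities of all `n` phases sum to `n^(1-a)`, which tends to 0 because `a >
    -- 1`.
    refine le_trans (le_of_eq ?_) (hN₄ n h4)
    rw [neg_sub, sub_eq_add_neg, Real.rpow_add (by linarith), Real.rpow_one]
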